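/- Let $(M,g)$ be a connected $n$-dimensional smooth Riemannian manifold with Riemannian distance $d$, and let $J=\mathbb{R}$ or $J=[t_0,\infty)$ for some $t_0\in\mathbb{R}$. Let $f$ be a smooth time-varying vector field on $M$ (that is, $f(x,t)\in T_xM$ depends smoothly on $(x,t)\in M\times\mathbb{R}$) which is complete in forward time: its flow $\Phi_f(t,s,x)$, defined by $\frac{d}{dt}\Phi_f(t,s,x)=f(\Phi_f(t,s,x),t)$ and $\Phi_f(s,s,x)=x$, exists for all $s\in J$, $t\ge s$ and $x\in M$. Let $\bar x\in M$ be an equilibrium, $\Phi_f(t,s,\bar x)=\bar x$ for all $s\in J$, $t\ge s$, and let $(U,\phi)$ be a smooth coordinate chart of $M$ with $\bar x\in U$. A continuous function $\alpha:[0,b)\to[0,\infty)$, $0<b\le\infty$, is of class $\mathcal{K}$ if it is strictly increasing and $\alpha(0)=0$. A continuous function $\beta:[0,b)\times[0,\infty)\to[0,\infty)$ is of class $\mathcal{KL}$ if $\beta(\cdot,\tau)$ is of class $\mathcal{K}$ for each $\tau\ge 0$, and $\beta(r,\cdot)$ is (not necessarily strictly) decreasing with $\lim_{\tau\to\infty}\beta(r,\tau)=0$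 for each $r\in[0,b)$. Suppose that there is a function $\beta:[0,b)\times[0,\infty)\to[0,\infty)$ of class $\mathcal{KL}$, where $d(x,\bar x)<b$ for all $x\in U$, such that $$d(\Phi_f(t,s,x_0),\bar x)\le\beta\big(d(x_0,\bar x),t-s\big)\qquad\text{for all } s\in J,\ t\ge s,\ x_0\in U,$$ and that $\|T_xf(\cdot,t)\|$ is bounded uniformly in $x\in U$ and $t\in J$, where $\|\cdot\|$ is the operator norm of the pushforward $T_xf(\cdot,t):T_xM\to T_{f(x,t)}TM$ with respect to $g$ on $M$ and the Sasaki metric of $g$ on $TM$ (the norm of $\xi\in TTM$ is given by $\|\xi\|^2=\|T\pi\,\xi\|_g^2+\|K\xi\|_g^2$, with $\pi:TM\to M$ the projection and $K$ the connector of the Levi-Civita connection). Then there are an open set $\mathcal{U}_{\bar x}\subset U$ containing $\bar x$, a smooth function $w:M\times\mathbb{R}\to[0,\infty)$, and functions $\alpha_1,\alpha_2,\alpha_3,\alpha_4:[0,\infty)\to[0,\infty)$ of class $\mathcal{K}$ such that $w$ is a Lyapunov function for $f$ at $\bar x$ for the times $t\in J$ (on some neighborhood of $\bar x$, the same for all $t\in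 J$, $w(\cdot,t)$ is positive definite and $\mathfrak{L}_fw(\cdot,t)$ is negative semi-definite, both vanishing at $\bar x$) and, for all $x\in\mathcal{U}_{\bar x}$ and $t\in J$, (i) $\alpha_1(d(x,\bar x))\le w(x,t)\le\alpha_2(d(x,\bar x))$; (ii) $\mathfrak{L}_{f(x,t)}w\le-\alpha_3(d(x,\bar x))$; (iii) $\|T_xw\|\le\alpha_4(d(x,\bar x))$. Here $\mathfrak{L}_{f(x,t)}w=d_xw(f(x,t))+\partial_tw(x,t)$, and $\|T_xw\|$ is the operator norm, with respect to $g$, of the differential at $x$ of $w(\cdot,t)$. -/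

import Mathlib

open Set Filter Topology Manifold Bundle
open scoped ContDiff ENNReal

noncomputable section

/-! ### Comparison functions -/

/-- The interval `[0, b)`, with `b ∈ (0, ∞]`. -/
def comparisonDomain (b : ℝ≥0∞) : Set ℝ := {r | 0 ≤ r ∧ ENNReal.ofReal r < b}

/-- `α : [0, b) → [0, ∞)` is of class `𝒦`: continuous, strictly increasing, `α 0 = 0`. -/
def IsClassK (b : ℝ≥0∞) (α : ℝ → ℝ) : Prop :=
  ContinuousOn α (comparisonDomain b) ∧ StrictMonoOn α (comparisonDomain b) ∧ α 0 = 0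

/-- `β : [0, b) × [0, ∞) → [0, ∞)` is of class `𝒦ℒ`: jointly continuous, of class `𝒦` in the
first variable, decreasing with limit `0` in the second one. -/
def IsClassKL (b : ℝ≥0∞) (β : ℝ → ℝ → ℝ) : Prop :=
  ContinuousOn (fun p : ℝ × ℝ => β p.1 p.2) (comparisonDomain b ×ˢ Ici (0 : ℝ)) ∧
  (∀ s, 0 ≤ s → IsClassK b (fun r => β r s)) ∧
  (∀ r ∈ comparisonDomain b, AntitoneOn (β r) (Ici (0 : ℝ)) ∧ Tendsto (β r) atTop (𝓝 0))

section Manifold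

variable {n : ℕ} {M : Type*} [TopologicalSpace M] [ChartedSpace (EuclideanSpace ℝ (Fin n)) M]
  [IsManifold (𝓡 n) ∞ M]

/-! ### Time-varying vector fields, flows, Lyapunov functions -/

/-- The time-varying vector field `(x, t) ↦ f x t ∈ T_x M` is smooth on `M × ℝ`. -/
def IsSmoothTimeVaryingField (f : (x : M) → ℝ → TangentSpace (𝓡 n) x) : Prop :=
  ContMDiff ((𝓡 n).prod 𝓘(ℝ, ℝ)) (𝓡 n).tangent ∞
    (fun p : M × ℝ => (⟨p.1, f p.1 p.2⟩ : TangentBundle (𝓡 n) M))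

/-- `Φ t s x` is the flow of `ẋ = f(x, t)`, started at the point `x` at the initial time `s ∈ J`
and defined for all later times `t ≥ s` (so `f` is complete in forward time). -/
def IsFlow (J : Set ℝ) (f : (x : M) → ℝ → TangentSpace (𝓡 n) x) (Φ : ℝ → ℝ → M → M) : Prop :=
  ∀ s ∈ J, ∀ x : M, Φ s s x = x ∧ ∀ t, s ≤ t →
    HasMFDerivWithinAt 𝓘(ℝ, ℝ) (𝓡 n) (fun τ => Φ τ s x) (Ici s) t
      ((1 : ℝ →L[ℝ] ℝ).smulRight (f (Φ t s x) t))

/-- `x̄` is an equilibrium: it is fixed by the flow. -/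
def IsEquilibrium (J : Set ℝ) (Φ : ℝ → ℝ → M → M) (xbar : M) : Prop :=
  ∀ s ∈ J, ∀ t, s ≤ t → Φ t s xbar = xbar

/-- The Lie derivative `dw(∂/∂t, f(x,t)) = d_x w (f(x,t)) + d_t w (∂/∂t)` at `(x, t)` of a
time-varying function `w : M × ℝ → ℝ` along a time-varying vector field. -/
def lieDerivative (f : (x : M) → ℝ → TangentSpace (𝓡 n) x) (w : M × ℝ → ℝ) (x : M) (t : ℝ) : ℝ :=
  (show ℝ from mfderiv (𝓡 n) 𝓘(ℝ, ℝ) (fun y => w (y, t)) x (f x t)) + deriv (fun τ => w (x, τ)) t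

/-- `w` is a Lyapunov function for `f` at `x̄`, for times in `J`: it is smooth on `M × ℝ`, and near
`x̄` it is positive definite and its Lie derivative along `f` is negative semi-definite. -/
def IsLyapunovFunction (J : Set ℝ) (f : (x : M) → ℝ → TangentSpace (𝓡 n) x) (xbar : M)
    (w : M × ℝ → ℝ) : Prop :=
  ContMDiff ((𝓡 n).prod 𝓘(ℝ, ℝ)) 𝓘(ℝ, ℝ) ∞ w ∧
  ∃ N ∈ 𝓝 xbar, ∀ t ∈ J,
    (w (xbar, t) = 0 ∧ ∀ x ∈ N, x ≠ xbar → 0 < w (x, t)) ∧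
    (lieDerivative f w xbar t = 0 ∧ ∀ x ∈ N, x ≠ xbar → lieDerivative f w x t ≤ 0)

/-! ### The norm of the pushforward `T_x f(·, t) : T_x M → T_{f(x,t)} TM`

The tangent bundle of a Riemannian manifold carries the Sasaki metric
`‖ξ‖² = ‖Tπ ξ‖² + ‖K ξ‖²`, with `π : TM → M` the projection and `K : TTM → TM` the connector of
the Levi-Civita connection. We write it in the coordinates of a smooth chart `e` of `M`; as the
metric is an invariant object, the value does not depend on the chart. -/

variable [RiemannianBundle (fun x : M => TangentSpace (𝓡 n) x)]

/-- The coefficients `g_{ij}` of the Riemannian metric in the chart `e`, at the point with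
coordinates `y`. -/
def coordMetric (e : OpenPartialHomeomorph M (EuclideanSpace ℝ (Fin n)))
    (y : EuclideanSpace ℝ (Fin n)) : Matrix (Fin n) (Fin n) ℝ :=
  Matrix.of fun i j =>
    inner ℝ (mfderiv (𝓡 n) (𝓡 n) e.symm y (EuclideanSpace.single i (1 : ℝ)))
      (mfderiv (𝓡 n) (𝓡 n) e.symm y (EuclideanSpace.single j (1 : ℝ)))

/-- The partial derivative `g_{ij,k} = ∂g_{ij}/∂x_k`. -/
def coordMetricDeriv (e : OpenPartialHomeomorph M (EuclideanSpace ℝ (Fin n)))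
    (y : EuclideanSpace ℝ (Fin n)) (i j k : Fin n) : ℝ :=
  fderiv ℝ (fun z => coordMetric e z i j) y (EuclideanSpace.single k (1 : ℝ))

/-- The Christoffel symbol `Γ^i_{jk} = ½ ∑_l g^{il} (g_{jl,k} + g_{kl,j} - g_{jk,l})` of the
Levi-Civita connection. -/
def christoffel (e : OpenPartialHomeomorph M (EuclideanSpace ℝ (Fin n)))
    (y : EuclideanSpace ℝ (Fin n)) (i j k : Fin n) : ℝ :=
  (1 / 2 : ℝ) * ∑ l, (coordMetric e y)⁻¹ i l *
    (coordMetricDeriv e y j l k + coordMetricDeriv e y k l j - coordMetricDeriv e y j k l)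

/-- The coordinates `(x, v) ↦ (e x, T_x e v)` on the tangent bundle induced by the chart `e`. -/
def tangentCoord (e : OpenPartialHomeomorph M (EuclideanSpace ℝ (Fin n)))
    (p : TangentBundle (𝓡 n) M) : EuclideanSpace ℝ (Fin n) × EuclideanSpace ℝ (Fin n) :=
  (e p.1, mfderiv (𝓡 n) (𝓡 n) e p.1 p.2)

/-- The Sasaki norm of `ξ ∈ T_p TM`, `p = (x, v)`, in coordinates: if `ξ` has the coordinates
`(a, b)` in the chart of `TM` induced by `e`, then `Tπ ξ` has the coordinates `a^i` and `K ξ` has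
the coordinates `b^i + ∑_{j,k} Γ^i_{jk} a^j v^k`. -/
def sasakiNorm (e : OpenPartialHomeomorph M (EuclideanSpace ℝ (Fin n)))
    (p : TangentBundle (𝓡 n) M) (ξ : TangentSpace (𝓡 n).tangent p) : ℝ :=
  let v : EuclideanSpace ℝ (Fin n) := (tangentCoord e p).2
  let ab : EuclideanSpace ℝ (Fin n) × EuclideanSpace ℝ (Fin n) :=
    mfderiv (𝓡 n).tangent
      𝓘(ℝ, EuclideanSpace ℝ (Fin n) × EuclideanSpace ℝ (Fin n)) (tangentCoord e) p ξ
  let c : Fin n → ℝ := fun i => ab.2 i + ∑ j, ∑ k, christoffel e (e p.1) i j k * ab.1 j * v k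
  Real.sqrt ((∑ i, ∑ j, coordMetric e (e p.1) i j * ab.1 i * ab.1 j) +
    ∑ i, ∑ j, coordMetric e (e p.1) i j * c i * c j)

/-- The operator norm of `T_x f(·, t) : T_x M → T_{f(x,t)} TM` is bounded, uniformly for `x` in
the domain of the chart `e` and `t ∈ J`. -/
def HasBoundedPushforward (J : Set ℝ) (e : OpenPartialHomeomorph M (EuclideanSpace ℝ (Fin n)))
    (f : (x : M) → ℝ → TangentSpace (𝓡 n) x) : Prop :=
  ∃ C : ℝ, ∀ t ∈ J, ∀ x ∈ e.source, ∀ X : TangentSpace (𝓡 n) x,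
    sasakiNorm e ⟨x, f x t⟩
      (mfderiv (𝓡 n) (𝓡 n).tangent (fun y => (⟨y, f y t⟩ : TangentBundle (𝓡 n) M)) x X) ≤ C * ‖X‖

end Manifold

end

/-! The Lyapunov function is a weighted sum of total costs. In coordinates centred at the
equilibrium, let `q` be smooth with values in `[0, 1]`, zero on a ball about the origin and one
farther out. By uniform attractivity every nearby trajectory stays in that ball after a time `T`
independent of its initial time and point. Hence the integral of `q` along the trajectory over `[0,
T]` is already the total future cost `V`, and discarding an initial piece of the trajectory shows
that `V` decreases along the flow at the rate exactly `q` (`exists_layer`). It is smooth as a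
component of the time-`T` map of an autonomous system with time and accumulated cost as extra states
(`IsLocallyBoundedFlow.contDiff`). Uniformly in time, it is bounded by `T`, its gradient is bounded
by Gronwall's inequality, and it vanishes near the origin by uniform stability.

Such costs are summed over shrinking balls with rapidly decreasing weights
(`exists_contDiff_tsum_mul`, `exists_lyapunov_of_isUniformlyStableFamily`). Near the origin the
first `N` terms vanish, so the sum and its gradient are small; away from it a single term bounds
both the sum and its rate of decrease from below. All this is uniform in time, and
`exists_isClassK_le` and `exists_isClassK_ge` turn it into class `𝒦` bounds.

The class `𝒦ℒ` estimate supplies stability and attractivity. The Sasaki bound supplies the Lipschitz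
constant: for the coordinate field `F`, the connector part of the pushforward is `DF u + Γ(u, F)`,
and since `F` vanishes at the origin, Gronwall's inequality along rays bounds `F`, and then `DF`
(`norm_fderiv_le_of_affine_bound`). Cutoffs in space and time make the field globally bounded
without changing it along the trajectories considered; a cutoff of the sum lets it be extended by
zero to the manifold. -/

/-! ### Autonomous differential equations: existence, uniqueness, linear equations -/

section Flow

open Metric NNReal

/-- `γ` solves the autonomous equation `γ' = H γ` on `[0, T]`, with right derivatives. -/
structure IsForwardSolution {X : Type*} [NormedAddCommGroup X] [NormedSpace ℝ X]
    (H : X → X) (T : ℝ) (γ : ℝ → X) : Prop where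
  continuousOn : ContinuousOn γ (Icc 0 T)
  hasDerivWithinAt : ∀ t ∈ Ico 0 T, HasDerivWithinAt γ (H (γ t)) (Ici t) t

/-- A family of solutions on `[0, T]`, one for every initial value, which is bounded for bounded
initial values. -/
structure IsLocallyBoundedFlow {X : Type*} [NormedAddCommGroup X] [NormedSpace ℝ X]
    (H : X → X) (T : ℝ) (ψ : ℝ → X → X) : Prop where
  zero : ∀ x, ψ 0 x = x
  solution : ∀ x, IsForwardSolution H T (fun t => ψ t x)
  bounded : ∀ r : ℝ, ∃ r' : ℝ, ∀ t ∈ Icc 0 T, ∀ x, ‖x‖ ≤ r → ‖ψ t x‖ ≤ r'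

section General

variable {X Y : Type*} [NormedAddCommGroup X] [NormedSpace ℝ X] [FiniteDimensional ℝ X]
  [NormedAddCommGroup Y] [NormedSpace ℝ Y]

theorem ContDiff.exists_lipschitzOnWith_closedBall {H : X → Y} (hH : ContDiff ℝ 1 H) (r : ℝ) :
    ∃ K : ℝ≥0, LipschitzOnWith K H (closedBall 0 r) ∧ ∀ x ∈ closedBall (0 : X) r,
      ‖fderiv ℝ H x‖ ≤ K := by
  have := FiniteDimensional.proper ℝ X
  obtain ⟨C, hC⟩ := (isCompact_closedBall (0 : X) r).exists_bound_of_continuousOn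
    (hH.continuous_fderiv one_ne_zero).continuousOn
  refine ⟨C.toNNReal, ?_, fun x hx => (hC x hx).trans (Real.le_coe_toNNReal C)⟩
  refine (convex_closedBall 0 r).lipschitzOnWith_of_nnnorm_fderiv_le
    (fun x _ => (hH.differentiable one_ne_zero) x) fun x hx => ?_
  rw [← NNReal.coe_le_coe]
  exact (hC x hx).trans (Real.le_coe_toNNReal C)

theorem IsForwardSolution.eqOn {H : X → X} (hH : ContDiff ℝ 1 H) {T : ℝ} {γ γ' : ℝ → X}
    (h : IsForwardSolution H T γ) (h' : IsForwardSolution H T γ') (h0 : γ 0 = γ' 0) :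
    EqOn γ γ' (Icc 0 T) := by
  obtain ⟨r, hr⟩ := isCompact_Icc.exists_bound_of_continuousOn h.continuousOn
  obtain ⟨r', hr'⟩ := isCompact_Icc.exists_bound_of_continuousOn h'.continuousOn
  obtain ⟨K, hK, -⟩ := hH.exists_lipschitzOnWith_closedBall (max r r')
  refine ODE_solution_unique_of_mem_Icc_right (v := fun _ => H)
    (s := fun _ => closedBall 0 (max r r')) (fun _ _ => hK) h.continuousOn h.hasDerivWithinAt
    (fun t ht => ?_) h'.continuousOn h'.hasDerivWithinAt (fun t ht => ?_) h0
  · simpa using Or.inl (hr t (Ico_subset_Icc_self ht))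
  · simpa using Or.inr (hr' t (Ico_subset_Icc_self ht))

theorem hasDerivWithinAt_Ici_of_Icc {γ : ℝ → Y} {γ' : Y} {T t : ℝ} (ht : t ∈ Ico 0 T)
    (h : HasDerivWithinAt γ γ' (Icc 0 T) t) : HasDerivWithinAt γ γ' (Ici t) t :=
  h.mono_of_mem_nhdsWithin (mem_of_superset (Icc_mem_nhdsGE ht.2) (Icc_subset_Icc_left ht.1))

/-- A bounded `C¹` vector field has solutions of any length. -/
theorem exists_isLocallyBoundedFlow {H : X → X} (hH : ContDiff ℝ 1 H) {B : ℝ}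
    (hB : ∀ x, ‖H x‖ ≤ B) {T : ℝ} (hT : 0 ≤ T) : ∃ ψ, IsLocallyBoundedFlow H T ψ := by
  have hB0 : 0 ≤ B := (norm_nonneg _).trans (hB 0)
  have key : ∀ x : X, ∃ γ : ℝ → X, γ 0 = x ∧
      ∀ t ∈ Icc 0 T, HasDerivWithinAt γ (H (γ t)) (Icc 0 T) t := by
    intro x
    obtain ⟨K, hK, -⟩ := hH.exists_lipschitzOnWith_closedBall (‖x‖ + B * T)
    -- At speed at most `B`, a curve cannot leave the ball of radius `B * T` before time `T`, so one
    -- application covers the whole interval.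
    have hPL : IsPicardLindelof (fun _ => H) (tmin := 0) (tmax := T) ⟨0, le_rfl, hT⟩ x
        (B * T).toNNReal 0 B.toNNReal K := by
      refine ⟨fun t _ => hK.mono ?_, fun _ _ => continuousOn_const, fun t _ y _ => ?_, ?_⟩
      · rw [Real.coe_toNNReal _ (by positivity)]
        intro y hy
        rw [mem_closedBall, dist_zero_right]
        rw [mem_closedBall, dist_eq_norm] at hy
        calc ‖y‖ = ‖x + (y - x)‖ := by congr 1; abel
          _ ≤ _ := (norm_add_le _ _).trans (by linarith)
      · rw [Real.coe_toNNReal _ hB0]; exact hB y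
      · rw [Real.coe_toNNReal _ hB0, Real.coe_toNNReal _ (by positivity)]
        simp [hT]
    exact hPL.exists_eq_forall_mem_Icc_hasDerivWithinAt₀
  choose ψ h0 hψ using key
  refine ⟨fun t x => ψ x t, h0, fun x => ⟨fun t ht => (hψ x t ht).continuousWithinAt,
    fun t ht => hasDerivWithinAt_Ici_of_Icc ht (hψ x t (Ico_subset_Icc_self ht))⟩,
    fun r => ⟨r + B * T, fun t ht x hx => ?_⟩⟩
  have := (convex_Icc 0 T).norm_image_sub_le_of_norm_hasDerivWithin_le (hψ x)
    (fun t _ => hB _) (left_mem_Icc.2 hT) ht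
  rw [h0, sub_zero, Real.norm_of_nonneg ht.1] at this
  have h2 : B * t ≤ B * T := mul_le_mul_of_nonneg_left ht.2 hB0
  calc ‖ψ x t‖ = ‖x + (ψ x t - x)‖ := by congr 1; abel
    _ ≤ _ := (norm_add_le _ _).trans (by linarith)

/-- Existence of the fundamental solution of a linear equation `D' = A(t) D`. -/
theorem exists_fundamentalSolution {T : ℝ} (hT : 0 ≤ T) {A : ℝ → X →L[ℝ] X}
    (hA : ContinuousOn A (Icc 0 T)) {K : ℝ} (hK : ∀ t ∈ Icc 0 T, ‖A t‖ ≤ K) :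
    ∃ D : ℝ → X →L[ℝ] X, D 0 = ContinuousLinearMap.id ℝ X ∧ ContinuousOn D (Icc 0 T) ∧
      (∀ t ∈ Ico 0 T, HasDerivWithinAt D ((A t).comp (D t)) (Ici t) t) ∧
      ∀ t ∈ Icc 0 T, ‖D t‖ ≤ Real.exp (K * T) := by
  have hK0 : 0 ≤ K := (norm_nonneg _).trans (hK 0 (left_mem_Icc.2 hT))
  set M := Real.exp (K * T) with hM
  have hM0 : 0 < M := Real.exp_pos _
  -- A linear field is unbounded, so it is truncated outside the ball of radius `M = exp (K * T)`,
  -- the Gronwall bound. Solutions of the truncated equation obey the same bound, hence never meet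
  -- the truncation.
  let χ : ContDiffBump (0 : X →L[ℝ] X) := ⟨M, M + 1, hM0, by linarith⟩
  set c : (X →L[ℝ] X) → (X →L[ℝ] X) := fun D => χ D • D with hc
  have hcs : ContDiff ℝ 1 c := χ.contDiff.smul contDiff_id
  have hcb : ∀ D, ‖c D‖ ≤ ‖D‖ := fun D => by
    rw [hc, norm_smul, Real.norm_of_nonneg χ.nonneg]
    exact mul_le_of_le_one_left (norm_nonneg _) χ.le_one
  have hcb' : ∀ D, ‖c D‖ ≤ M + 1 := fun D => by
    by_cases h : ‖D‖ < M + 1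
    · exact (hcb D).trans h.le
    · have : χ D = 0 := χ.zero_of_le_dist (by simpa using h)
      simp only [hc, this, zero_smul, norm_zero]
      positivity
  set I := ContinuousLinearMap.id ℝ X
  obtain ⟨L, hL, -⟩ := hcs.exists_lipschitzOnWith_closedBall (‖I‖ + K * (M + 1) * T)
  have hPL : IsPicardLindelof (fun t D => (A t).comp (c D)) (tmin := 0) (tmax := T)
      ⟨0, le_rfl, hT⟩ I (K * (M + 1) * T).toNNReal 0 (K * (M + 1)).toNNReal
      (K.toNNReal * L) := by
    refine ⟨fun t ht => ?_, fun D _ => hA.clm_comp continuousOn_const, fun t ht D _ => ?_, ?_⟩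
    · rw [Real.coe_toNNReal _ (by positivity)]
      refine LipschitzOnWith.of_dist_le_mul fun D hD D' hD' => ?_
      have hsub : ∀ D ∈ closedBall I (K * (M + 1) * T),
          D ∈ closedBall (0 : X →L[ℝ] X) (‖I‖ + K * (M + 1) * T) := fun y hy => by
        rw [mem_closedBall, dist_zero_right]
        rw [mem_closedBall, dist_eq_norm] at hy
        calc ‖y‖ = ‖I + (y - I)‖ := by congr 1; abel
          _ ≤ _ := (norm_add_le _ _).trans (by linarith)
      rw [dist_eq_norm, ← ContinuousLinearMap.comp_sub]
      have h1 := hL.dist_le_mul D (hsub D hD) D' (hsub D' hD')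
      rw [dist_eq_norm (c D)] at h1
      calc ‖(A t).comp (c D - c D')‖ ≤ ‖A t‖ * ‖c D - c D'‖ :=
            ContinuousLinearMap.opNorm_comp_le _ _
        _ ≤ K * (L * dist D D') := mul_le_mul (hK t ht) h1 (norm_nonneg _) hK0
        _ = _ := by rw [NNReal.coe_mul, Real.coe_toNNReal _ hK0]; ring
    · rw [Real.coe_toNNReal _ (by positivity)]
      exact (ContinuousLinearMap.opNorm_comp_le _ _).trans
        (mul_le_mul (hK t ht) (hcb' D) (norm_nonneg _) hK0)
    · rw [Real.coe_toNNReal _ (by positivity), Real.coe_toNNReal _ (by positivity)]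
      simp [hT]
  obtain ⟨D, hD0, hD⟩ := hPL.exists_eq_forall_mem_Icc_hasDerivWithinAt₀
  have hDc : ContinuousOn D (Icc 0 T) := fun t ht => (hD t ht).continuousWithinAt
  have hbound : ∀ t ∈ Icc 0 T, ‖D t‖ ≤ M := by
    intro t ht
    have := norm_le_gronwallBound_of_norm_deriv_right_le (f := D) (δ := 1) (K := K) (ε := 0) hDc
      (fun t ht => hasDerivWithinAt_Ici_of_Icc ht (hD t (Ico_subset_Icc_self ht)))
      (by rw [show D 0 = I from hD0]; exact ContinuousLinearMap.norm_id_le)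
      (fun t ht => by
        rw [add_zero]
        exact (ContinuousLinearMap.opNorm_comp_le _ _).trans
          (mul_le_mul (hK t (Ico_subset_Icc_self ht)) (hcb _) (norm_nonneg _) hK0)) t ht
    rw [gronwallBound_ε0, one_mul, sub_zero] at this
    exact this.trans (Real.exp_le_exp.2 (mul_le_mul_of_nonneg_left ht.2 hK0))
  refine ⟨D, hD0, hDc, fun t ht => ?_, hbound⟩
  have h1 := hasDerivWithinAt_Ici_of_Icc ht (hD t (Ico_subset_Icc_self ht))
  have h2 : χ (D t) = 1 := χ.one_of_mem_closedBall (by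
    simpa using hbound t (Ico_subset_Icc_self ht))
  simpa [hc, h2] using h1

/-- The derivative is Lipschitz on the ball, and the mean value inequality applies on the segment.
This controls the error of the linearized flow. -/
theorem ContDiff.exists_quadratic_bound {H : X → X} (hH : ContDiff ℝ 2 H) (r : ℝ) :
    ∃ C : ℝ, 0 ≤ C ∧ ∀ p u : X, ‖p‖ ≤ r → ‖p + u‖ ≤ r →
      ‖H (p + u) - H p - fderiv ℝ H p u‖ ≤ C * ‖u‖ ^ 2 := by
  have hd : ContDiff ℝ 1 (fderiv ℝ H) := hH.fderiv_right (by norm_num)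
  obtain ⟨K, hK, -⟩ := hd.exists_lipschitzOnWith_closedBall r
  refine ⟨K, K.2, fun p u hp hu => ?_⟩
  have hp' : p ∈ closedBall (0 : X) r := by simpa using hp
  have hu' : p + u ∈ closedBall (0 : X) r := by simpa using hu
  have hseg : segment ℝ p (p + u) ⊆ closedBall 0 r := (convex_closedBall 0 r).segment_subset hp' hu'
  have := (convex_segment p (p + u)).norm_image_sub_le_of_norm_hasFDerivWithin_le'
    (f := H) (f' := fderiv ℝ H) (φ := fderiv ℝ H p) (C := K * ‖u‖)
    (fun x _ => ((hH.differentiable two_ne_zero) x).hasFDerivAt.hasFDerivWithinAt)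
    (fun x hx => by
      have h1 := hK.dist_le_mul x (hseg hx) p hp'
      rw [dist_eq_norm, dist_eq_norm] at h1
      refine h1.trans (mul_le_mul_of_nonneg_left ?_ K.2)
      have := norm_sub_le_of_mem_segment hx
      simpa using this)
    (left_mem_segment ℝ _ _) (right_mem_segment ℝ _ _)
  rw [add_sub_cancel_left] at this
  calc _ ≤ _ := this
    _ = _ := by ring

end General

end Flow

/-! ### Smooth dependence on initial values -/

section Flow

open Metric NNReal

section General

variable {X : Type*} [NormedAddCommGroup X] [NormedSpace ℝ X] [FiniteDimensional ℝ X]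

/-- Lets an error quadratic in the perturbation be factored out of Gronwall's bound. -/
theorem gronwallBound_zero_eq_mul (K ε x : ℝ) :
    gronwallBound 0 K ε x = ε * gronwallBound 0 K 1 x := by
  simp only [gronwallBound]
  split_ifs <;> ring

/-- The derivative of a flow with respect to the initial value solves the variational equation. -/
theorem IsLocallyBoundedFlow.exists_hasFDerivAt {H : X → X} (hH : ContDiff ℝ 2 H) {T : ℝ}
    (hT : 0 ≤ T) {ψ : ℝ → X → X} (hψ : IsLocallyBoundedFlow H T ψ) :
    ∃ D : ℝ → X → X →L[ℝ] X, (∀ x, D 0 x = ContinuousLinearMap.id ℝ X) ∧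
      (∀ x, ContinuousOn (fun t => D t x) (Icc 0 T)) ∧
      (∀ x, ∀ t ∈ Ico 0 T,
        HasDerivWithinAt (fun t => D t x) ((fderiv ℝ H (ψ t x)).comp (D t x)) (Ici t) t) ∧
      (∀ r : ℝ, ∃ M : ℝ, ∀ t ∈ Icc 0 T, ∀ x, ‖x‖ ≤ r → ‖D t x‖ ≤ M) ∧
      ∀ t ∈ Icc 0 T, ∀ x, HasFDerivAt (ψ t) (D t x) x := by
  have hH1 : ContDiff ℝ 1 H := hH.of_le one_le_two
  have hdc : Continuous (fderiv ℝ H) := hH.continuous_fderiv two_ne_zero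
  have key : ∀ x, ∃ D : ℝ → X →L[ℝ] X, D 0 = ContinuousLinearMap.id ℝ X ∧
      ContinuousOn D (Icc 0 T) ∧
      (∀ t ∈ Ico 0 T, HasDerivWithinAt D ((fderiv ℝ H (ψ t x)).comp (D t)) (Ici t) t) ∧
      -- The bound is kept for every admissible `K`, so that after choosing `D` point by point a
      -- single `K` can serve a whole ball of initial values.
      ∀ K, (∀ t ∈ Icc 0 T, ‖fderiv ℝ H (ψ t x)‖ ≤ K) → ∀ t ∈ Icc 0 T,
        ‖D t‖ ≤ Real.exp (K * T) := by
    intro x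
    have hAc : ContinuousOn (fun t => fderiv ℝ H (ψ t x)) (Icc 0 T) :=
      hdc.comp_continuousOn (hψ.solution x).continuousOn
    obtain ⟨K, hK⟩ := isCompact_Icc.exists_bound_of_continuousOn hAc
    obtain ⟨D, h0, hc, hd, -⟩ := exists_fundamentalSolution hT hAc hK
    refine ⟨D, h0, hc, hd, fun K' hK' t ht => ?_⟩
    have hK0 : 0 ≤ K' := (norm_nonneg _).trans (hK' 0 (left_mem_Icc.2 hT))
    have := norm_le_gronwallBound_of_norm_deriv_right_le (f := D) (δ := 1) (K := K') (ε := 0) hc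
      hd (by rw [h0]; exact ContinuousLinearMap.norm_id_le)
      (fun t ht => by
        rw [add_zero]
        exact (ContinuousLinearMap.opNorm_comp_le _ _).trans
          (mul_le_mul_of_nonneg_right (hK' t (Ico_subset_Icc_self ht)) (norm_nonneg _))) t ht
    rw [gronwallBound_ε0, one_mul, sub_zero] at this
    exact this.trans (Real.exp_le_exp.2 (mul_le_mul_of_nonneg_left ht.2 hK0))
  choose D hD0 hDc hDd hDb using key
  have hbd : ∀ r : ℝ, ∃ M : ℝ, ∀ t ∈ Icc 0 T, ∀ x, ‖x‖ ≤ r → ‖D x t‖ ≤ M := by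
    intro r
    obtain ⟨r', hr'⟩ := hψ.bounded r
    obtain ⟨K, -, hK⟩ := hH1.exists_lipschitzOnWith_closedBall r'
    exact ⟨Real.exp (K * T), fun t ht x hx => hDb x K
      (fun t ht => hK _ (by simpa using hr' t ht x hx)) t ht⟩
  refine ⟨fun t x => D x t, hD0, hDc, hDd, hbd, fun t ht x => ?_⟩
  obtain ⟨M, hM⟩ := hbd (‖x‖ + 1)
  obtain ⟨r, hr⟩ := hψ.bounded (‖x‖ + 1)
  have hM0 : 0 ≤ M := (norm_nonneg _).trans (hM 0 (left_mem_Icc.2 hT) x (by linarith))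
  set R := r + M with hR
  obtain ⟨K, hK, -⟩ := hH1.exists_lipschitzOnWith_closedBall R
  obtain ⟨C, hC0, hC⟩ := hH.exists_quadratic_bound R
  set G := gronwallBound 0 K 1 t with hG
  have hG0 : 0 ≤ G := by
    have := gronwallBound_mono (δ := 0) (ε := 1) (K := K) le_rfl zero_le_one K.2 ht.1
    rwa [gronwallBound_x0] at this
  -- The curve `ψ s x + D x s h` has the same initial value as `ψ s (x + h)` and solves the equation
  -- up to an error `C * (M * ‖h‖) ^ 2`; Gronwall's inequality compares the two.
  have main : ∀ h : X, ‖h‖ ≤ 1 → ‖ψ t (x + h) - ψ t x - D x t h‖ ≤ C * M ^ 2 * G * ‖h‖ ^ 2 := by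
    intro h hh
    have hb1 : ∀ s ∈ Icc 0 T, ‖ψ s x‖ ≤ r := fun s hs => hr s hs x (by linarith)
    have hb2 : ∀ s ∈ Icc 0 T, ‖D x s h‖ ≤ M * ‖h‖ := fun s hs =>
      (D x s).le_of_opNorm_le (hM s hs x (by linarith)) h
    have hb3 : ∀ s ∈ Icc 0 T, ‖ψ s x + D x s h‖ ≤ R := fun s hs =>
      (norm_add_le _ _).trans (add_le_add (hb1 s hs)
        ((hb2 s hs).trans (mul_le_of_le_one_right hM0 hh)))
    have hsub : Icc 0 t ⊆ Icc 0 T := Icc_subset_Icc_right ht.2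
    have hsub' : ∀ s ∈ Ico 0 t, s ∈ Ico 0 T := fun s hs => ⟨hs.1, hs.2.trans_le ht.2⟩
    have := dist_le_of_approx_trajectories_ODE_of_mem (v := fun _ => H)
      (s := fun _ => closedBall 0 R) (K := K) (f := fun s => ψ s (x + h))
      (g := fun s => ψ s x + D x s h) (a := 0) (b := t) (εf := 0) (εg := C * (M * ‖h‖) ^ 2)
      (δ := 0) (fun _ _ => hK) ((hψ.solution _).continuousOn.mono hsub)
      (fun s hs => (hψ.solution _).hasDerivWithinAt s (hsub' s hs)) (by simp)
      (fun s hs => by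
        rw [mem_closedBall, dist_zero_right]
        refine (hr s (hsub (Ico_subset_Icc_self hs)) _ ((norm_add_le _ _).trans ?_)).trans ?_
        · linarith
        · linarith)
      (((hψ.solution _).continuousOn.add ((hDc x).clm_apply continuousOn_const)).mono hsub)
      (fun s hs => ((hψ.solution _).hasDerivWithinAt s (hsub' s hs)).add
        ((hDd x s (hsub' s hs)).clm_apply (hasDerivWithinAt_const _ _ h)))
      (fun s hs => by
        have hs' := hsub (Ico_subset_Icc_self hs)
        have := hC (ψ s x) (D x s h) ((hb1 s hs').trans (by linarith)) (hb3 s hs')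
        rw [dist_comm, dist_eq_norm]
        simp only [ContinuousLinearMap.comp_apply, map_zero, add_zero]
        rw [← sub_sub]
        refine this.trans ?_
        gcongr
        exact hb2 s hs')
      (fun s hs => by
        rw [mem_closedBall, dist_zero_right]; exact hb3 s (hsub (Ico_subset_Icc_self hs)))
      (by simp [hψ.zero, hD0]) t (right_mem_Icc.2 ht.1)
    rw [dist_eq_norm, zero_add, sub_zero, gronwallBound_zero_eq_mul, ← sub_sub] at this
    calc _ ≤ _ := this
      _ = _ := by ring
  rw [hasFDerivAt_iff_isLittleO_nhds_zero]
  refine Asymptotics.IsBigO.trans_isLittleO (g := fun h : X => ‖h‖ ^ 2)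
    (Asymptotics.IsBigO.of_bound (C * M ^ 2 * G) ?_) (Asymptotics.isLittleO_norm_pow_id one_lt_two)
  filter_upwards [closedBall_mem_nhds (0 : X) one_pos] with h hh
  rw [norm_pow, norm_norm]
  exact main h (by simpa using hh)

end General

/-- The vector field of the variational equation. -/
noncomputable def variationalField {X : Type*} [NormedAddCommGroup X] [NormedSpace ℝ X] (H : X → X)
    (p : X × X) : X × X := (H p.1, fderiv ℝ H p.1 p.2)

/-- The flow together with its derivative applied to a vector is the flow of the variational field
on `X × X`, so the induction runs over all spaces and fields at once. Local boundedness of the flow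
passes to the variational flow, whereas boundedness of the field would not. -/
theorem IsLocallyBoundedFlow.contDiff_nat (k : ℕ) : ∀ {X : Type*} [NormedAddCommGroup X]
    [NormedSpace ℝ X] [FiniteDimensional ℝ X] {H : X → X} (_ : ContDiff ℝ ∞ H) {T : ℝ}
    (_ : 0 ≤ T) {ψ : ℝ → X → X} (_ : IsLocallyBoundedFlow H T ψ) {t : ℝ} (_ : t ∈ Icc 0 T),
    ContDiff ℝ k (ψ t) := by
  induction k with
  | zero =>
    intro X _ _ _ H hH T hT ψ hψ t ht
    obtain ⟨D, -, -, -, -, hD⟩ := hψ.exists_hasFDerivAt (by exact_mod_cast contDiff_infty.1 hH 2) hT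
    exact contDiff_zero.2 (continuous_iff_continuousAt.2 fun x => (hD t ht x).continuousAt)
  | succ k ih =>
    intro X _ _ _ H hH T hT ψ hψ t ht
    obtain ⟨D, hD0, hDc, hDd, hDb, hD⟩ :=
      hψ.exists_hasFDerivAt (by exact_mod_cast contDiff_infty.1 hH 2) hT
    have hf : fderiv ℝ (ψ t) = D t := funext fun x => (hD t ht x).fderiv
    have hV : ContDiff ℝ ∞ (variationalField H) :=
      (hH.comp contDiff_fst).prodMk
        ((((hH.fderiv_right (m := ∞) (by simp)).comp contDiff_fst)).clm_apply contDiff_snd)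
    have hfl : IsLocallyBoundedFlow (variationalField H) T
        (fun t p => (ψ t p.1, D t p.1 p.2)) := by
      refine ⟨fun p => by simp [hψ.zero, hD0], fun p => ⟨?_, fun s hs => ?_⟩, fun r => ?_⟩
      · exact (hψ.solution p.1).continuousOn.prodMk ((hDc p.1).clm_apply continuousOn_const)
      · refine ((hψ.solution p.1).hasDerivWithinAt s hs).prodMk ?_
        simpa using (hDd p.1 s hs).clm_apply (hasDerivWithinAt_const _ _ p.2)
      · obtain ⟨r', hr'⟩ := hψ.bounded r
        obtain ⟨M, hM⟩ := hDb r
        refine ⟨max r' (M * r), fun s hs p hp => ?_⟩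
        have h1 : ‖p.1‖ ≤ r := (norm_fst_le p).trans hp
        have h2 : ‖p.2‖ ≤ r := (norm_snd_le p).trans hp
        have hM0 : 0 ≤ M := (norm_nonneg _).trans (hM s hs _ h1)
        refine max_le_max (hr' s hs _ h1) ?_
        exact ((D s p.1).le_of_opNorm_le (hM s hs _ h1) _).trans
          (mul_le_mul_of_nonneg_left h2 hM0)
    push_cast
    rw [contDiff_succ_iff_fderiv]
    refine ⟨fun x => (hD t ht x).differentiableAt, by simp, ?_⟩
    rw [hf, contDiff_clm_apply_iff]
    intro v
    exact contDiff_snd.comp ((ih hV hT hfl ht).comp (contDiff_id.prodMk contDiff_const))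

/-- Solutions of a smooth differential equation depend smoothly on the initial value. -/
theorem IsLocallyBoundedFlow.contDiff {X : Type*} [NormedAddCommGroup X]
    [NormedSpace ℝ X] [FiniteDimensional ℝ X] {H : X → X} (hH : ContDiff ℝ ∞ H) {T : ℝ}
    (hT : 0 ≤ T) {ψ : ℝ → X → X} (hψ : IsLocallyBoundedFlow H T ψ) {t : ℝ} (ht : t ∈ Icc 0 T) :
    ContDiff ℝ ∞ (ψ t) :=
  contDiff_infty.2 fun k => hψ.contDiff_nat k hH hT ht

end Flow

/-! ### Smooth series with small coefficients -/

section Series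

open Metric

/-- A series of smooth functions with sufficiently small coefficients is smooth, and it can be
differentiated term by term. -/
theorem exists_contDiff_tsum_mul {X : Type*} [NormedAddCommGroup X] [NormedSpace ℝ X]
    [FiniteDimensional ℝ X] {g : ℕ → X → ℝ} (hg : ∀ k, ContDiff ℝ ∞ (g k)) :
    ∃ a : ℕ → ℝ, (∀ k, 0 < a k) ∧ ∀ b : ℕ → ℝ, (∀ k, 0 ≤ b k ∧ b k ≤ a k) →
      ContDiff ℝ ∞ (fun x => ∑' k, b k * g k x) ∧
      ∀ x, (Summable fun k => b k * g k x) ∧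
        ∀ v, HasSum (fun k => b k * fderiv ℝ (g k) x v)
          (fderiv ℝ (fun x => ∑' k, b k * g k x) x v) := by
  -- The `g k` may be unbounded. Multiplied by a bump they have bounded derivatives of each order,
  -- and every point has a neighbourhood on which some bump is one.
  let η : ℕ → ContDiffBump (0 : X) := fun m => ⟨m + 1, m + 2, by positivity, by linarith⟩
  have hηg : ∀ m k, ContDiff ℝ ∞ (fun x => η m x * g k x) := fun m k =>
    (η m).contDiff.mul (hg k)
  have hsupp : ∀ m k, HasCompactSupport (fun x => η m x * g k x) := fun m k =>
    (η m).hasCompactSupport.mul_right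
  have key : ∀ i m k : ℕ, ∃ C, ∀ x, ‖iteratedFDeriv ℝ i (fun x => η m x * g k x) x‖ ≤ C :=
    fun i m k => ((hsupp m k).iteratedFDeriv i).exists_bound_of_continuous
      ((hηg m k).continuous_iteratedFDeriv (by exact_mod_cast le_top))
  choose C hC using key
  have hC0 : ∀ i m k, 0 ≤ C i m k := fun i m k => (norm_nonneg _).trans (hC i m k 0)
  -- Diagonal choice: the `k`-th coefficient controls the orders `i ≤ k` and balls `m ≤ k`. For
  -- fixed `i` and `m` this misses only finitely many `k`.
  let S : ℕ → ℝ := fun k => ∑ i ∈ Finset.range (k + 1), ∑ m ∈ Finset.range (k + 1), C i m k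
  have hS0 : ∀ k, 0 ≤ S k := fun k =>
    Finset.sum_nonneg fun i _ => Finset.sum_nonneg fun m _ => hC0 i m k
  refine ⟨fun k => (1 / 2) ^ k / (1 + S k), fun k => div_pos (by positivity) (by linarith [hS0 k]),
    fun b hb => ?_⟩
  have hbC : ∀ i m k, i ≤ k → m ≤ k → b k * C i m k ≤ (1 / 2) ^ k := by
    intro i m k hi hm
    have h1 : C i m k ≤ S k := by
      refine le_trans ?_ (Finset.single_le_sum
        (f := fun i => ∑ m ∈ Finset.range (k + 1), C i m k)
        (fun i _ => Finset.sum_nonneg fun m _ => hC0 i m k)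
        (Finset.mem_range.2 (Nat.lt_succ_of_le hi)))
      exact Finset.single_le_sum (f := fun m => C i m k) (fun m _ => hC0 i m k)
        (Finset.mem_range.2 (Nat.lt_succ_of_le hm))
    have h2 : 0 < 1 + S k := by linarith [hS0 k]
    calc b k * C i m k ≤ (1 / 2) ^ k / (1 + S k) * (1 + S k) :=
          mul_le_mul (hb k).2 (by linarith) (hC0 i m k) ((hb k).1.trans (hb k).2)
      _ = _ := div_mul_cancel₀ _ h2.ne'
  have hsum : ∀ i m, Summable fun k => b k * C i m k := fun i m => by
    refine Summable.of_norm_bounded_eventually_nat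
      (summable_geometric_of_lt_one (r := (1 / 2 : ℝ)) (by norm_num) (by norm_num)) ?_
    filter_upwards [eventually_ge_atTop (max i m)] with k hk
    rw [Real.norm_of_nonneg (mul_nonneg (hb k).1 (hC0 i m k))]
    exact hbC i m k ((le_max_left _ _).trans hk) ((le_max_right _ _).trans hk)
  have hterm : ∀ m k, ContDiff ℝ ∞ (fun x => b k * (η m x * g k x)) := fun m k =>
    contDiff_const.mul (hηg m k)
  have hsm : ∀ m, ContDiff ℝ ∞ (fun x => ∑' k, b k * (η m x * g k x)) := fun m => by
    refine contDiff_tsum (v := fun i k => b k * C i m k) (fun k => hterm m k)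
      (fun i _ => hsum i m) fun i k x _ => ?_
    have : (fun x => b k * (η m x * g k x)) = b k • (fun x => η m x * g k x) := rfl
    rw [this, iteratedFDeriv_const_smul_apply
      (((hηg m k).of_le (by exact_mod_cast le_top)).contDiffAt), norm_smul,
      Real.norm_of_nonneg (hb k).1]
    exact mul_le_mul_of_nonneg_left (hC i m k x) (hb k).1
  have hone : ∀ x : X, ∃ m : ℕ, ∀ᶠ y in 𝓝 x, η m y = 1 := fun x => by
    obtain ⟨m, hm⟩ := exists_nat_gt ‖x‖
    refine ⟨m, ?_⟩
    have : ball (0 : X) (m + 1) ∈ 𝓝 x := isOpen_ball.mem_nhds (by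
      rw [mem_ball, dist_zero_right]; linarith)
    filter_upwards [this] with y hy
    exact (η m).one_of_mem_closedBall (ball_subset_closedBall hy)
  have hloc : ∀ x : X, ∃ m : ℕ, (fun x => ∑' k, b k * g k x) =ᶠ[𝓝 x]
      (fun x => ∑' k, b k * (η m x * g k x)) ∧ ∀ k, g k =ᶠ[𝓝 x] fun x => η m x * g k x := by
    intro x
    obtain ⟨m, hm⟩ := hone x
    refine ⟨m, ?_, fun k => ?_⟩
    · filter_upwards [hm] with y hy
      simp [hy]
    · filter_upwards [hm] with y hy
      simp [hy]
  refine ⟨contDiff_iff_contDiffAt.2 fun x => ?_, fun x => ?_⟩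
  · obtain ⟨m, hm, -⟩ := hloc x
    exact (hsm m).contDiffAt.congr_of_eventuallyEq hm
  · obtain ⟨m, hm, hm'⟩ := hloc x
    have hsx : ∀ y, Summable fun k => b k * (η m y * g k y) := fun y => by
      refine Summable.of_norm_bounded (hsum 0 m) fun k => ?_
      have := hC 0 m k y
      rw [norm_iteratedFDeriv_zero] at this
      rw [norm_mul, Real.norm_of_nonneg (hb k).1]
      exact mul_le_mul_of_nonneg_left this (hb k).1
    have hd : ∀ k y, HasFDerivAt (fun x => b k * (η m x * g k x))
        (b k • fderiv ℝ (fun x => η m x * g k x) y) y := fun k y =>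
      (((hηg m k).differentiable (by simp)) y).hasFDerivAt.const_mul (b k)
    have hdb : ∀ k y, ‖b k • fderiv ℝ (fun x => η m x * g k x) y‖ ≤ b k * C 1 m k := fun k y => by
      rw [norm_smul, Real.norm_of_nonneg (hb k).1, ← norm_iteratedFDeriv_one]
      exact mul_le_mul_of_nonneg_left (hC 1 m k y) (hb k).1
    have hD := hasFDerivAt_tsum (hsum 1 m) hd hdb (hsx x) x
    refine ⟨(hsx x).congr fun k => congrArg (b k * ·) (hm' k).self_of_nhds.symm, fun v => ?_⟩
    rw [hm.fderiv_eq, hD.fderiv]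
    have hs2 : Summable fun k => b k • fderiv ℝ (fun x => η m x * g k x) x :=
      Summable.of_norm_bounded (hsum 1 m) fun k => hdb k x
    have := (ContinuousLinearMap.apply ℝ ℝ v).hasSum hs2.hasSum
    refine this.congr_fun ?_
    intro k
    simp [(hm' k).fderiv_eq]

end Series

/-! ### Class `𝒦` bounds from uniform estimates -/

section Comparison

theorem mem_comparisonDomain_top {r : ℝ} : r ∈ comparisonDomain ⊤ ↔ 0 ≤ r := by
  simp [comparisonDomain]

theorem isClassK_top {α : ℝ → ℝ} (h1 : Continuous α) (h2 : StrictMonoOn α (Ici 0))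
    (h3 : α 0 = 0) : IsClassK ⊤ α := by
  have : comparisonDomain ⊤ = Ici 0 := by ext r; exact mem_comparisonDomain_top
  exact ⟨h1.continuousOn, this ▸ h2, h3⟩

/-- A function which is bounded away from zero away from `ρ = 0` is bounded below by a function of
class `𝒦` of `ρ`. -/
theorem exists_isClassK_le {S : Type*} {ρ q : S → ℝ} (hρ : ∀ s, 0 ≤ ρ s) (hq : ∀ s, 0 ≤ q s)
    (h : ∀ r > 0, ∃ c > 0, ∀ s, r ≤ ρ s → c ≤ q s) :
    ∃ α, IsClassK ⊤ α ∧ ∀ s, α (ρ s) ≤ q s := by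
  rcases isEmpty_or_nonempty S with hS | hS
  · exact ⟨id, isClassK_top continuous_id strictMonoOn_id rfl, fun s => (hS.false s).elim⟩
  -- The infimum over `s` of these monotone 1-Lipschitz functions of `r` is monotone and
  -- 1-Lipschitz, and at `r = ρ s` it is at most `q s`.
  let m : S → ℝ → ℝ := fun s r => q s + max 0 (r - ρ s)
  have hm0 : ∀ s r, 0 ≤ m s r := fun s r => add_nonneg (hq s) (le_max_left _ _)
  have hbdd : ∀ r, BddBelow (range fun s => m s r) := fun r => ⟨0, by rintro _ ⟨s, rfl⟩; exact hm0 s r⟩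
  let A : ℝ → ℝ := fun r => ⨅ s, m s r
  have hAmono : Monotone A := fun r r' hr => ciInf_mono (hbdd r) fun s => by
    simp only [m]; gcongr
  have hAlip : ∀ r r', A r ≤ A r' + |r - r'| := fun r r' => by
    rw [← sub_le_iff_le_add]
    refine le_ciInf fun s => ?_
    rw [sub_le_iff_le_add]
    refine (ciInf_le (hbdd r) s).trans ?_
    simp only [m]
    rw [add_assoc]
    gcongr
    refine max_le (by positivity) ?_
    linarith [le_max_right 0 (r' - ρ s), le_abs_self (r - r')]
  have hAcont : Continuous A := by
    refine (LipschitzWith.of_dist_le_mul (K := 1) fun r r' => ?_).continuous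
    rw [Real.dist_eq, Real.dist_eq, NNReal.coe_one, one_mul, abs_le]
    constructor
    · have := hAlip r' r
      rw [abs_sub_comm] at this
      linarith
    · linarith [hAlip r r']
  have hApos : ∀ r > 0, 0 < A r := fun r hr => by
    obtain ⟨c, hc, hcs⟩ := h (r / 2) (by linarith)
    refine (lt_min hc (half_pos hr)).trans_le (le_ciInf fun s => ?_)
    rcases le_or_gt (r / 2) (ρ s) with h1 | h1
    · exact (min_le_left _ _).trans ((hcs s h1).trans (le_add_of_nonneg_right (le_max_left _ _)))
    · refine (min_le_right _ _).trans ?_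
      simp only [m]
      linarith [hq s, le_max_right 0 (r - ρ s)]
  have hA0 : ∀ r, 0 ≤ A r := fun r => le_ciInf fun s => hm0 s r
  have hAle : ∀ s, A (ρ s) ≤ q s := fun s => (ciInf_le (hbdd _) s).trans (by simp [m])
  -- The factor lies in `[0, 1)`, vanishes at zero and makes the product strictly increasing.
  refine ⟨fun r => A r * (|r| / (1 + |r|)), isClassK_top ?_ ?_ (by simp), fun s => ?_⟩
  · exact hAcont.mul (continuous_abs.div (continuous_const.add continuous_abs)
      fun r => by positivity)
  · intro r hr r' hr' hrr
    have hr0 : (0 : ℝ) ≤ r := hr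
    have hr'0 : (0 : ℝ) < r' := hr0.trans_lt hrr
    simp only [abs_of_nonneg hr0, abs_of_pos hr'0]
    refine mul_lt_mul' (hAmono hrr.le) ?_ (by positivity) (hApos r' hr'0)
    rw [div_lt_div_iff₀ (by positivity) (by positivity)]
    nlinarith
  · simp only [abs_of_nonneg (hρ s)]
    refine (mul_le_of_le_one_right (hA0 _) ?_).trans (hAle s)
    rw [div_le_one (by linarith [hρ s])]
    linarith

/-- A bounded function which tends to zero with `ρ` is bounded above by a function of class `𝒦`
of `ρ`. -/
theorem exists_isClassK_ge {S : Type*} {ρ q : S → ℝ} (hρ : ∀ s, 0 ≤ ρ s) {B : ℝ}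
    (hB : ∀ s, q s ≤ B) (h : ∀ ε > 0, ∃ δ > 0, ∀ s, ρ s < δ → q s ≤ ε) :
    ∃ α, IsClassK ⊤ α ∧ ∀ s, q s ≤ α (ρ s) := by
  choose! δ hδ hδq using h
  let B' := |B| + 1
  have hB' : 0 < B' := by positivity
  let d : ℕ → ℝ := fun k => δ (B' * (1 / 2) ^ k)
  have hd : ∀ k, 0 < d k := fun k => hδ _ (by positivity)
  let u : ℕ → ℝ := fun k => (1 / 2) ^ k
  have hu0 : ∀ k, 0 < u k := fun k => by positivity
  have hu : HasSum u 2 := hasSum_geometric_two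
  -- A ramp that reaches its full height `u k` when `r = d k`, the threshold below which `q` is at
  -- most `B' * (1 / 2) ^ k`.
  let t : ℕ → ℝ → ℝ := fun k r => u k * min 1 (|r| / d k)
  have ht0 : ∀ k r, 0 ≤ t k r := fun k r =>
    mul_nonneg (hu0 k).le (le_min zero_le_one (div_nonneg (abs_nonneg _) (hd k).le))
  have htu : ∀ k r, t k r ≤ u k := fun k r => mul_le_of_le_one_right (hu0 k).le (min_le_left _ _)
  have hts : ∀ r, Summable fun k => t k r := fun r =>
    Summable.of_nonneg_of_le (fun k => ht0 k r) (fun k => htu k r) hu.summable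
  have htc : Continuous fun r => ∑' k, t k r := by
    refine continuous_tsum (fun k => ?_) hu.summable fun k r => ?_
    · exact continuous_const.mul (continuous_const.min (continuous_abs.div_const _))
    · rw [Real.norm_of_nonneg (ht0 k r)]; exact htu k r
  refine ⟨fun r => r + 2 * B' * ∑' k, t k r, isClassK_top ?_ ?_ ?_, fun s => ?_⟩
  · exact continuous_id.add (continuous_const.mul htc)
  · intro r hr r' hr' hrr
    have hr0 : (0 : ℝ) ≤ r := hr
    refine add_lt_add_of_lt_of_le hrr (mul_le_mul_of_nonneg_left ?_ (by positivity))
    refine (hts r).tsum_le_tsum (fun k => ?_) (hts r')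
    refine mul_le_mul_of_nonneg_left (min_le_min le_rfl ?_) (hu0 k).le
    rw [abs_of_nonneg hr0, abs_of_nonneg (hr0.trans hrr.le)]
    exact div_le_div_of_nonneg_right hrr.le (hd k).le
  · simp [t]
  · by_cases hs : ∀ k, ρ s < d k
    · have : q s ≤ 0 := by
        have hlim : Tendsto (fun k : ℕ => B' * (1 / 2 : ℝ) ^ k) atTop (𝓝 (B' * 0)) :=
          (tendsto_pow_atTop_nhds_zero_of_lt_one (by norm_num) (by norm_num)).const_mul _
        rw [mul_zero] at hlim
        exact ge_of_tendsto' hlim fun k => hδq _ (by positivity) s (hs k)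
      have h2 : 0 ≤ ∑' k, t k (ρ s) := tsum_nonneg fun k => ht0 k _
      have h3 := hρ s
      have : 0 ≤ 2 * B' * ∑' k, t k (ρ s) := by positivity
      linarith
    · push Not at hs
      classical
      -- For the first `k` with `d k ≤ ρ s`, the ramp `k` is saturated, while the threshold `k - 1`
      -- gives `q s ≤ B' * (2 * u k)`; for `k = 0` the global bound does. This explains the
      -- coefficient `2 * B'`.
      have hk := Nat.find_spec hs
      set k := Nat.find hs with hkdef
      have h1 : t k (ρ s) = u k := by
        simp only [t]
        rw [min_eq_left, mul_one]
        rw [abs_of_nonneg (hρ s), le_div_iff₀ (hd k), one_mul]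
        exact hk
      have h2 : u k ≤ ∑' k, t k (ρ s) := h1 ▸ (hts _).le_tsum k fun j _ => ht0 j _
      have h3 : q s ≤ B' * (2 * u k) := by
        rcases Nat.eq_zero_or_pos k with h0 | h0
        · rw [h0]
          have := hB s
          have := le_abs_self B
          simp only [u, B', pow_zero]
          linarith [abs_nonneg B]
        · have hlt : ρ s < d (k - 1) := by
            have := Nat.find_min hs (m := k - 1) (by omega)
            push Not at this
            exact this
          have := hδq _ (by positivity) s hlt
          refine this.trans (le_of_eq ?_)
          congr 1
          obtain ⟨j, hj⟩ : ∃ j, k = j + 1 := ⟨k - 1, by omega⟩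
          simp [u, pow_succ, hj]
      have h4 : B' * u k ≤ B' * ∑' k, t k (ρ s) := mul_le_mul_of_nonneg_left h2 hB'.le
      simp only []
      linarith [hρ s]

end Comparison

/-! ### One layer: the total cost of a radial step -/

section Layer

open Metric NNReal

/-- `Y s y τ` is the position at time `s + τ` of the solution of `y' = F(y, t)` started at the time
`s ∈ J` at the point `y` of the ball of radius `δ`; the solutions stay in the ball of radius `R`,
and the origin is uniformly stable and uniformly attractive. -/
structure IsUniformlyStableFamily {E : Type*} [NormedAddCommGroup E] [NormedSpace ℝ E] (J : Set ℝ)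
    (F : E → ℝ → E) (δ R : ℝ) (Y : ℝ → E → ℝ → E) : Prop where
  initial : ∀ s ∈ J, ∀ y, ‖y‖ < δ → Y s y 0 = y
  continuous : ∀ s ∈ J, ∀ y, ‖y‖ < δ → Continuous (Y s y)
  hasDerivWithinAt : ∀ s ∈ J, ∀ y, ‖y‖ < δ → ∀ τ, 0 ≤ τ →
    HasDerivWithinAt (Y s y) (F (Y s y τ) (s + τ)) (Ici τ) τ
  norm_lt : ∀ s ∈ J, ∀ y, ‖y‖ < δ → ∀ τ, 0 ≤ τ → ‖Y s y τ‖ < R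
  stable : ∀ ε > 0, ∃ δ' > 0, ∀ s ∈ J, ∀ y, ‖y‖ < δ → ‖y‖ < δ' → ∀ τ, 0 ≤ τ → ‖Y s y τ‖ < ε
  attractive : ∀ ε > 0, ∃ T : ℝ, ∀ s ∈ J, ∀ y, ‖y‖ < δ → ∀ τ, 0 ≤ τ → T ≤ τ → ‖Y s y τ‖ < ε

variable {E : Type*} [NormedAddCommGroup E] [NormedSpace ℝ E]

/-- The vector field on `(E × ℝ) × ℝ` whose last component accumulates the cost `q`. -/
def costField (G : E → ℝ → E) (q : E → ℝ) (p : (E × ℝ) × ℝ) : (E × ℝ) × ℝ :=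
  ((G p.1.1 p.1.2, 1), q p.1.1)

theorem contDiff_costField {G : E → ℝ → E} {q : E → ℝ}
    (hG : ContDiff ℝ ∞ (fun p : E × ℝ => G p.1 p.2)) (hq : ContDiff ℝ ∞ q) :
    ContDiff ℝ ∞ (costField G q) :=
  ((hG.comp contDiff_fst).prodMk contDiff_const).prodMk
    (hq.comp (contDiff_fst.comp contDiff_fst))

/-- By uniqueness: the trajectory, the clock and the running integral together solve the augmented
equation. With time a state variable, smoothness in the initial value includes smoothness in `t`. -/
theorem cost_eq_integral [FiniteDimensional ℝ E] {G : E → ℝ → E} {q : E → ℝ}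
    (hG : ContDiff ℝ ∞ (fun p : E × ℝ => G p.1 p.2)) (hq : ContDiff ℝ ∞ q) {T : ℝ} (hT : 0 ≤ T)
    {ψ : ℝ → (E × ℝ) × ℝ → (E × ℝ) × ℝ} (hψ : IsLocallyBoundedFlow (costField G q) T ψ)
    {γ : ℝ → E} {t : ℝ} (hγ : Continuous γ)
    (hγ' : ∀ τ, 0 ≤ τ → HasDerivWithinAt γ (G (γ τ) (t + τ)) (Ici τ) τ) :
    (ψ T ((γ 0, t), 0)).2 = ∫ τ in (0 : ℝ)..T, q (γ τ) := by
  have hqc : Continuous fun τ => q (γ τ) := hq.continuous.comp hγ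
  have hI : ∀ τ, HasDerivAt (fun u => ∫ σ in (0 : ℝ)..u, q (γ σ)) (q (γ τ)) τ := fun τ =>
    (hqc.integral_hasStrictDerivAt 0 τ).hasDerivAt
  have hsol : IsForwardSolution (costField G q) T
      (fun τ => ((γ τ, t + τ), ∫ σ in (0 : ℝ)..τ, q (γ σ))) := by
    refine ⟨Continuous.continuousOn ?_, fun τ hτ => ?_⟩
    · exact (hγ.prodMk (continuous_const.add continuous_id)).prodMk
        (continuous_iff_continuousAt.2 fun τ => (hI τ).continuousAt)
    · exact ((hγ' τ hτ.1).prodMk ((hasDerivWithinAt_id τ _).const_add t)).prodMk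
        (hI τ).hasDerivWithinAt
  have := (hψ.solution ((γ 0, t), 0)).eqOn
    ((contDiff_costField hG hq).of_le (by exact_mod_cast le_top)) hsol
    (by simp [hψ.zero]) (right_mem_Icc.2 hT)
  exact congrArg Prod.snd this

/-- A smooth function which decreases along the trajectories at the rate `q`, where `q` vanishes
near the origin. -/
theorem exists_layer [FiniteDimensional ℝ E] {J : Set ℝ} (hJ : ∀ s ∈ J, ∀ t, s ≤ t → t ∈ J) {G : E → ℝ → E}
    (hG : ContDiff ℝ ∞ (fun p : E × ℝ => G p.1 p.2)) {B : ℝ} (hB : ∀ y t, ‖G y t‖ ≤ B)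
    {δ R : ℝ} {Y : ℝ → E → ℝ → E} (hY : IsUniformlyStableFamily J G δ R Y)
    {L : ℝ≥0} (hL : ∀ t ∈ J, LipschitzOnWith L (fun y => G y t) (ball 0 R))
    {q : E → ℝ} (hq : ContDiff ℝ ∞ q) (hq0 : ∀ y, 0 ≤ q y) (hq1 : ∀ y, q y ≤ 1)
    {r r' : ℝ} (hr : 0 < r) (hr' : 0 < r') (hqr : ∀ y, ‖y‖ ≤ r → q y = 0)
    (hqr' : ∀ y, r' ≤ ‖y‖ → q y = 1) :
    ∃ V : E × ℝ → ℝ, ContDiff ℝ ∞ V ∧ (∀ p, 0 ≤ V p) ∧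
      (∀ t ∈ J, ∀ y, ‖y‖ < δ → fderiv ℝ V (y, t) (G y t, 1) = -q y) ∧
      (∃ c > 0, ∀ t ∈ J, ∀ y, ‖y‖ < δ → 2 * r' ≤ ‖y‖ → c ≤ V (y, t)) ∧
      (∃ C, 0 ≤ C ∧ ∀ t ∈ J, ∀ y, ‖y‖ < δ → V (y, t) ≤ C ∧
        ∀ u, |fderiv ℝ V (y, t) (u, 0)| ≤ C * ‖u‖) ∧
      ∃ δ' > 0, ∀ t ∈ J, ∀ y, ‖y‖ < δ → ‖y‖ < δ' → V (y, t) = 0 ∧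
        ∀ u, fderiv ℝ V (y, t) (u, 0) = 0 := by
  have hB0 : 0 ≤ B := (norm_nonneg _).trans (hB 0 0)
  obtain ⟨T₀, hT₀⟩ := hY.attractive r hr
  -- After `T₀` the cost rate is zero; `T ≥ 1` leaves room for the time `τ₁ ≤ 1` used in the lower
  -- bound.
  set T := max T₀ 1 with hTdef
  have hT1 : 1 ≤ T := le_max_right _ _
  have hT : 0 ≤ T := zero_le_one.trans hT1
  have hH := contDiff_costField hG hq
  have hHb : ∀ p, ‖costField G q p‖ ≤ max (max B 1) 1 := fun p => by
    simp only [costField, Prod.norm_mk, norm_one]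
    gcongr
    · exact hB _ _
    · rw [Real.norm_of_nonneg (hq0 _)]; exact hq1 _
  obtain ⟨ψ, hψ⟩ := exists_isLocallyBoundedFlow (hH.of_le (by exact_mod_cast le_top)) hHb hT
  let V : E × ℝ → ℝ := fun p => (ψ T (p, 0)).2
  have hV : ContDiff ℝ ∞ V :=
    contDiff_snd.comp ((hψ.contDiff hH hT (right_mem_Icc.2 hT)).comp
      (contDiff_id.prodMk contDiff_const))
  have hVint : ∀ t ∈ J, ∀ y, ‖y‖ < δ → V (y, t) = ∫ τ in (0 : ℝ)..T, q (Y t y τ) := by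
    intro t ht y hy
    have := cost_eq_integral hG hq hT hψ (hY.continuous t ht y hy) (hY.hasDerivWithinAt t ht y hy)
    rw [← this, hY.initial t ht y hy]
  have hqc : ∀ t ∈ J, ∀ y, ‖y‖ < δ → Continuous fun τ => q (Y t y τ) := fun t ht y hy =>
    hq.continuous.comp (hY.continuous t ht y hy)
  have hzero : ∀ t ∈ J, ∀ y, ‖y‖ < δ → ∀ τ, T ≤ τ → q (Y t y τ) = 0 := fun t ht y hy τ hτ =>
    hqr _ (hT₀ t ht y hy τ (hT.trans hτ) ((le_max_left _ _).trans hτ)).le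
  have hVd : ∀ p, HasFDerivAt V (fderiv ℝ V p) p := fun p =>
    ((hV.differentiable (by simp)) p).hasFDerivAt
  have hpart : ∀ y t, HasFDerivAt (fun y => V (y, t))
      ((fderiv ℝ V (y, t)).comp (ContinuousLinearMap.inl ℝ E ℝ)) y := fun y t =>
    HasFDerivAt.comp (g := V) (f := fun y => (y, t)) y (hVd (y, t)) (hasFDerivAt_prodMk_left y t)
  refine ⟨V, hV, fun p => ?_, fun t ht y hy => ?_, ?_, ?_, ?_⟩
  · have hs := hψ.solution (p, 0)
    refine image_le_of_deriv_right_le_deriv_boundary (f := fun _ => (0 : ℝ)) (f' := fun _ => 0)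
      (B := fun τ => (ψ τ (p, 0)).2) (B' := fun τ => q (ψ τ (p, 0)).1.1) (a := 0) (b := T)
      continuousOn_const (fun τ _ => hasDerivWithinAt_const _ _ _) (by simp [hψ.zero])
      (continuous_snd.comp_continuousOn hs.continuousOn) (fun τ hτ => ?_)
      (fun τ _ => hq0 _) (right_mem_Icc.2 hT)
    exact (hs.hasDerivWithinAt τ hτ).snd
  · set γ := Y t y with hγ
    have hγc := hY.continuous t ht y hy
    have hγ0 : γ 0 = y := hY.initial t ht y hy
    -- The cost from time `t + h` on is the integral over `[h, T + h]`, and the piece over `[T, T +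
    -- h]` vanishes. Differentiating at `h = 0` from the right, directly and by the chain rule,
    -- gives the rate of decrease.
    have hshift : ∀ h, 0 ≤ h →
        V (γ h, t + h) = (∫ τ in (0 : ℝ)..T, q (γ τ)) - ∫ τ in (0 : ℝ)..h, q (γ τ) := by
      intro h hh
      have h1 := cost_eq_integral hG hq hT hψ (γ := fun τ => γ (τ + h)) (t := t + h)
        (hγc.comp (continuous_id.add continuous_const)) (fun τ hτ => by
          have h2 := hY.hasDerivWithinAt t ht y hy (τ + h) (by linarith)
          have h3 : HasDerivWithinAt (fun τ => τ + h) 1 (Ici τ) τ :=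
            (hasDerivWithinAt_id τ _).add_const h
          have h4 := HasDerivWithinAt.scomp τ h2 h3 (fun x hx => by
            simp only [mem_Ici] at hx ⊢; linarith)
          rw [one_smul] at h4
          rw [add_assoc, add_comm h τ]
          exact h4)
      have h2 : V (γ h, t + h) = ∫ τ in (0 : ℝ)..T, q (γ (τ + h)) := by
        rw [← h1]; simp [V]
      have hi : ∀ a b, IntervalIntegrable (fun τ => q (γ τ)) MeasureTheory.volume a b :=
        fun a b => (hqc t ht y hy).intervalIntegrable a b
      have h3 : ∫ τ in T..(T + h), q (γ τ) = 0 := by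
        rw [intervalIntegral.integral_congr (g := fun _ => (0 : ℝ)) (fun τ hτ => ?_)]
        · simp
        · rw [uIcc_of_le (by linarith)] at hτ
          exact hzero t ht y hy τ hτ.1
      rw [h2, intervalIntegral.integral_comp_add_right (fun τ => q (γ τ)) h, zero_add,
        ← intervalIntegral.integral_add_adjacent_intervals (hi h T) (hi T (T + h)), h3, add_zero,
        intervalIntegral.integral_interval_sub_left (hi 0 T) (hi 0 h)]
    have hd1 : HasDerivWithinAt (fun h => V (γ h, t + h)) (-q y) (Ici 0) 0 := by
      have h1 : HasDerivAt (fun u => ∫ σ in (0 : ℝ)..u, q (γ σ)) (q (γ 0)) 0 :=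
        ((hqc t ht y hy).integral_hasStrictDerivAt 0 0).hasDerivAt
      rw [hγ0] at h1
      have h2 := (h1.hasDerivWithinAt (s := Ici 0)).const_sub (∫ τ in (0 : ℝ)..T, q (γ τ))
      exact h2.congr (fun h hh => hshift h hh) (hshift 0 le_rfl)
    have hd2 : HasDerivWithinAt (fun h => V (γ h, t + h)) (fderiv ℝ V (y, t) (G y t, 1))
        (Ici 0) 0 := by
      have h1 := hY.hasDerivWithinAt t ht y hy 0 le_rfl
      rw [← hγ, hγ0, add_zero] at h1
      have h2 := h1.prodMk ((hasDerivWithinAt_id (0 : ℝ) (Ici 0)).const_add t)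
      have h3 : HasFDerivAt V (fderiv ℝ V (y, t)) (γ 0, t + id (0 : ℝ)) := by
        simpa [hγ0] using hVd (y, t)
      exact h3.comp_hasDerivWithinAt 0 h2
    exact (uniqueDiffOn_Ici (0 : ℝ) 0 self_mem_Ici).eq_deriv _ hd2 hd1
  -- At speed at most `B`, a point starting at distance `2 * r'` or more needs longer than this to
  -- come closer than `r'`, and until then it pays cost at rate one.
  · set τ₁ := min 1 (r' / (B + 1)) with hτ₁
    have hτpos : 0 < τ₁ := lt_min one_pos (div_pos hr' (by linarith))
    refine ⟨τ₁, hτpos, fun t ht y hy hyr => ?_⟩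
    have hγc := hY.continuous t ht y hy
    have hmove : ∀ τ ∈ Icc 0 τ₁, q (Y t y τ) = 1 := by
      intro τ hτ
      refine hqr' _ ?_
      have h1 := norm_image_sub_le_of_norm_deriv_right_le_segment (f := Y t y) (a := 0) (b := τ₁)
        hγc.continuousOn (fun τ hτ => hY.hasDerivWithinAt t ht y hy τ hτ.1)
        (fun τ _ => hB _ _) τ hτ
      rw [hY.initial t ht y hy, sub_zero] at h1
      have h2 : B * τ ≤ r' := by
        calc B * τ ≤ (B + 1) * (r' / (B + 1)) := by
              gcongr
              · exact hτ.1
              · linarith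
              · exact hτ.2.trans (min_le_right _ _)
          _ = r' := mul_div_cancel₀ _ (by linarith)
      have h3 := norm_sub_norm_le y (Y t y τ)
      rw [norm_sub_rev] at h3
      linarith
    rw [hVint t ht y hy]
    have hi : ∀ a b, IntervalIntegrable (fun τ => q (Y t y τ)) MeasureTheory.volume a b :=
      fun a b => (hqc t ht y hy).intervalIntegrable a b
    have hle : τ₁ ≤ T := (min_le_left _ _).trans hT1
    rw [← intervalIntegral.integral_add_adjacent_intervals (hi 0 τ₁) (hi τ₁ T)]
    have h1 : ∫ τ in (0 : ℝ)..τ₁, q (Y t y τ) = τ₁ := by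
      rw [intervalIntegral.integral_congr (g := fun _ => (1 : ℝ)) (fun τ hτ => ?_)]
      · simp
      · rw [uIcc_of_le hτpos.le] at hτ
        exact hmove τ hτ
    have h2 : 0 ≤ ∫ τ in τ₁..T, q (Y t y τ) :=
      intervalIntegral.integral_nonneg hle fun τ _ => hq0 _
    linarith
  · obtain ⟨K, hK, -⟩ := (hq.of_le (m := 1)
      (by exact_mod_cast le_top)).exists_lipschitzOnWith_closedBall R
    obtain ⟨C, hC⟩ : ∃ C : ℝ≥0, (C : ℝ) = T * (K * Real.exp (L * T)) :=
      ⟨⟨_, by positivity⟩, rfl⟩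
    -- The time-independent gradient bound comes from this Lipschitz constant: on `[0, T]`
    -- trajectories separate at most by the factor `exp (L * T)`, and `q` is Lipschitz on the ball
    -- that contains them.
    have hlip : ∀ t ∈ J, LipschitzOnWith C (fun y => V (y, t)) (ball 0 δ) := by
      intro t ht
      refine LipschitzOnWith.of_dist_le_mul fun y hy y' hy' => ?_
      rw [mem_ball, dist_zero_right] at hy hy'
      have hclose : ∀ τ ∈ Icc 0 T, |q (Y t y τ) - q (Y t y' τ)| ≤
          K * Real.exp (L * T) * dist y y' := by
        intro τ hτ
        have h1 := dist_le_of_trajectories_ODE_of_mem (v := fun τ y => G y (t + τ))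
          (s := fun _ => ball (0 : E) R) (K := L) (f := Y t y) (g := Y t y') (a := 0) (b := T)
          (δ := dist y y')
          (fun τ hτ => hL (t + τ) (hJ t ht _ (by linarith [hτ.1])))
          (hY.continuous t ht y hy).continuousOn
          (fun τ hτ => hY.hasDerivWithinAt t ht y hy τ hτ.1)
          (fun τ hτ => by simpa using hY.norm_lt t ht y hy τ hτ.1)
          (hY.continuous t ht y' hy').continuousOn
          (fun τ hτ => hY.hasDerivWithinAt t ht y' hy' τ hτ.1)
          (fun τ hτ => by simpa using hY.norm_lt t ht y' hy' τ hτ.1)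
          (by rw [hY.initial t ht y hy, hY.initial t ht y' hy']) τ hτ
        have h2 := hK.dist_le_mul (Y t y τ)
          (by simpa using (hY.norm_lt t ht y hy τ hτ.1).le) (Y t y' τ)
          (by simpa using (hY.norm_lt t ht y' hy' τ hτ.1).le)
        rw [Real.dist_eq] at h2
        refine h2.trans ?_
        rw [mul_assoc]
        refine mul_le_mul_of_nonneg_left (h1.trans ?_) K.2
        rw [mul_comm]
        refine mul_le_mul_of_nonneg_right (Real.exp_le_exp.2 ?_) dist_nonneg
        rw [sub_zero]
        exact mul_le_mul_of_nonneg_left hτ.2 L.2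
      rw [Real.dist_eq]
      simp only [hVint t ht y hy, hVint t ht y' hy']
      rw [← intervalIntegral.integral_sub ((hqc t ht y hy).intervalIntegrable _ _)
        ((hqc t ht y' hy').intervalIntegrable _ _)]
      have := intervalIntegral.norm_integral_le_of_norm_le_const (a := 0) (b := T)
        (f := fun τ => q (Y t y τ) - q (Y t y' τ)) (C := K * Real.exp (L * T) * dist y y')
        (fun τ hτ => by
          rw [uIoc_of_le hT] at hτ
          exact hclose τ (Ioc_subset_Icc_self hτ))
      rw [sub_zero, abs_of_nonneg hT, Real.norm_eq_abs] at this
      refine this.trans (le_of_eq ?_)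
      rw [hC]
      ring
    refine ⟨max C T, le_max_of_le_left C.2, fun t ht y hy => ⟨?_, fun u => ?_⟩⟩
    · refine le_max_of_le_right ?_
      rw [hVint t ht y hy]
      have := intervalIntegral.integral_mono_on hT ((hqc t ht y hy).intervalIntegrable 0 T)
        (intervalIntegrable_const (μ := MeasureTheory.volume) (c := (1 : ℝ))) (fun τ _ => hq1 _)
      simpa using this
    · have h1 := norm_fderiv_le_of_lipschitzOn ℝ
        (isOpen_ball.mem_nhds (by simpa using hy : y ∈ ball (0 : E) δ)) (hlip t ht)
      rw [(hpart y t).fderiv] at h1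
      have h2 := ContinuousLinearMap.le_of_opNorm_le _ h1 u
      rw [ContinuousLinearMap.comp_apply, ContinuousLinearMap.inl_apply, Real.norm_eq_abs] at h2
      exact h2.trans (mul_le_mul_of_nonneg_right (le_max_left _ _) (norm_nonneg _))
  -- Trajectories starting close enough never leave the ball where `q` vanishes, so `V` is zero near
  -- such points and its spatial derivative is too.
  · obtain ⟨δ', hδ', hst⟩ := hY.stable r hr
    have hV0 : ∀ t ∈ J, ∀ y, ‖y‖ < δ → ‖y‖ < δ' → V (y, t) = 0 := by
      intro t ht y hy hy'
      rw [hVint t ht y hy, intervalIntegral.integral_congr (g := fun _ => (0 : ℝ)) (fun τ hτ => ?_)]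
      · simp
      · rw [uIcc_of_le hT] at hτ
        exact hqr _ (hst t ht y hy hy' τ hτ.1).le
    refine ⟨δ', hδ', fun t ht y hy hy' => ⟨hV0 t ht y hy hy', fun u => ?_⟩⟩
    have hev : (fun y => V (y, t)) =ᶠ[𝓝 y] fun _ => 0 := by
      filter_upwards [isOpen_ball.mem_nhds (by simpa using hy : y ∈ ball (0 : E) δ),
        isOpen_ball.mem_nhds (by simpa using hy' : y ∈ ball (0 : E) δ')] with z hz hz'
      exact hV0 t ht z (by simpa using hz) (by simpa using hz')
    have h1 := hev.fderiv_eq (𝕜 := ℝ)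
    rw [(hpart y t).fderiv, fderiv_const_apply] at h1
    simpa using congrArg (fun A => A u) h1

end Layer

/-! ### Summation of the layers -/

section Core

open Metric NNReal

variable {E : Type*} [NormedAddCommGroup E]

/-- A smooth function with values in `[0, 1]` which vanishes on the ball of radius `r` and is equal
to `1` outside the ball of radius `2 * r`. -/
noncomputable def radialStep (r : ℝ) (y : E) : ℝ := Real.smoothTransition ((‖y‖ ^ 2 - r ^ 2) / (3 * r ^ 2))

theorem radialStep_of_le {r : ℝ} {y : E} (hy : ‖y‖ ≤ r) : radialStep r y = 0 := by
  refine Real.smoothTransition.zero_of_nonpos (div_nonpos_of_nonpos_of_nonneg ?_ (by positivity))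
  have := pow_le_pow_left₀ (norm_nonneg y) hy 2
  linarith

theorem radialStep_of_ge {r : ℝ} (hr : 0 < r) {y : E} (hy : 2 * r ≤ ‖y‖) : radialStep r y = 1 := by
  refine Real.smoothTransition.one_of_one_le ?_
  rw [one_le_div (by positivity)]
  have := pow_le_pow_left₀ (by positivity) hy 2
  nlinarith

variable [InnerProductSpace ℝ E]

theorem contDiff_radialStep (r : ℝ) : ContDiff ℝ ∞ (radialStep r : E → ℝ) :=
  Real.smoothTransition.contDiff.comp (((contDiff_norm_sq ℝ).sub contDiff_const).div_const _)

/-- A smooth Lyapunov function near a uniformly asymptotically stable equilibrium, in a vector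
space. -/
theorem exists_lyapunov_of_isUniformlyStableFamily [FiniteDimensional ℝ E] {J : Set ℝ}
    (hJ : ∀ s ∈ J, ∀ t, s ≤ t → t ∈ J) {G : E → ℝ → E}
    (hG : ContDiff ℝ ∞ (fun p : E × ℝ => G p.1 p.2)) {B : ℝ} (hB : ∀ y t, ‖G y t‖ ≤ B)
    {δ R : ℝ} (hδ : 0 < δ) {Y : ℝ → E → ℝ → E} (hY : IsUniformlyStableFamily J G δ R Y)
    {L : ℝ≥0} (hL : ∀ t ∈ J, LipschitzOnWith L (fun y => G y t) (ball 0 R))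
    {R₀ : ℝ} (hR₀ : 0 < R₀) :
    ∃ W : E × ℝ → ℝ, ContDiff ℝ ∞ W ∧ (∀ p, 0 ≤ W p) ∧ (∀ p, R₀ ≤ ‖p.1‖ → W p = 0) ∧
      ∃ δ₁ > 0, δ₁ ≤ R₀ ∧
      (∀ t ∈ J, ∀ y, ‖y‖ < δ₁ → fderiv ℝ W (y, t) (G y t, 1) ≤ 0) ∧
      (∀ r > 0, ∃ c > 0, ∀ t ∈ J, ∀ y, ‖y‖ < δ₁ → r ≤ ‖y‖ →
        c ≤ W (y, t) ∧ fderiv ℝ W (y, t) (G y t, 1) ≤ -c) ∧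
      (∃ C, ∀ t ∈ J, ∀ y, ‖y‖ < δ₁ →
        W (y, t) ≤ C ∧ ∀ u, |fderiv ℝ W (y, t) (u, 0)| ≤ C * ‖u‖) ∧
      ∀ ε > 0, ∃ δ' > 0, ∀ t ∈ J, ∀ y, ‖y‖ < δ₁ → ‖y‖ < δ' →
        W (y, t) ≤ ε ∧ ∀ u, |fderiv ℝ W (y, t) (u, 0)| ≤ ε * ‖u‖ := by
  let r : ℕ → ℝ := fun k => 1 / (k + 1)
  have hr : ∀ k, 0 < r k := fun k => Nat.one_div_pos_of_nat
  have hlayer := fun k => exists_layer hJ hG hB hY hL (contDiff_radialStep (E := E) (r k))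
    (fun _ => Real.smoothTransition.nonneg _) (fun _ => Real.smoothTransition.le_one _) (hr k)
    (mul_pos two_pos (hr k)) (fun _ => radialStep_of_le) (fun _ => radialStep_of_ge (hr k))
  choose V hV hV0 hVG hVc hVC hVz using hlayer
  choose c hc hVc using hVc
  choose C hC0 hVC using hVC
  choose d hd hVz using hVz
  obtain ⟨a, ha, hab⟩ := exists_contDiff_tsum_mul hV
  -- The first bound makes the series smooth on all of `E × ℝ`; the second makes it and its gradient
  -- converge uniformly for `t ∈ J`.
  let b : ℕ → ℝ := fun k => min (a k) ((1 / 4) ^ k / (1 + C k))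
  have hC1 : ∀ k, 0 < 1 + C k := fun k => by linarith [hC0 k]
  have hb : ∀ k, 0 < b k := fun k => lt_min (ha k) (div_pos (by positivity) (hC1 k))
  have hbC : ∀ k, b k * C k ≤ (1 / 4) ^ k := fun k =>
    calc b k * C k ≤ (1 / 4) ^ k / (1 + C k) * (1 + C k) :=
          mul_le_mul (min_le_right _ _) (by linarith) (hC0 k) (by have := hC1 k; positivity)
      _ = _ := div_mul_cancel₀ _ (hC1 k).ne'
  obtain ⟨hS, hSum⟩ := hab b fun k => ⟨(hb k).le, min_le_left _ _⟩
  set S : E × ℝ → ℝ := fun p => ∑' k, b k * V k p with hSdef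
  have hgeom : HasSum (fun k : ℕ => (1 / 2 : ℝ) ^ k) 2 := hasSum_geometric_two
  -- the terms are small, uniformly in time
  have hsmall : ∀ (N : ℕ), ∀ t ∈ J, ∀ y, ‖y‖ < δ → (∀ k < N, ‖y‖ < d k) →
      S (y, t) ≤ (1 / 2) ^ N * 2 ∧
      ∀ u, |fderiv ℝ S (y, t) (u, 0)| ≤ (1 / 2) ^ N * 2 * ‖u‖ := by
    intro N t ht y hy hN
    -- One factor `(1 / 2) ^ k` supplies the smallness of the tail, the other its summability.
    have hpow : ∀ k, N ≤ k → (1 / 4 : ℝ) ^ k ≤ (1 / 2) ^ N * (1 / 2) ^ k := fun k hk => by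
      have h1 : (1 / 4 : ℝ) ^ k = (1 / 2) ^ k * (1 / 2) ^ k := by rw [← mul_pow]; norm_num
      rw [h1]
      refine mul_le_mul_of_nonneg_right ?_ (by positivity)
      exact pow_le_pow_of_le_one (by norm_num) (by norm_num) hk
    refine ⟨hasSum_le (fun k => ?_) (hSum (y, t)).1.hasSum (hgeom.mul_left ((1 / 2) ^ N)),
      fun u => ?_⟩
    · rcases lt_or_ge k N with hk | hk
      · rw [(hVz k t ht y hy (hN k hk)).1, mul_zero]; positivity
      · exact ((mul_le_mul_of_nonneg_left (hVC k t ht y hy).1 (hb k).le).trans (hbC k)).trans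
          (hpow k hk)
    · rw [← ((hSum (y, t)).2 (u, 0)).tsum_eq, ← Real.norm_eq_abs]
      refine tsum_of_norm_bounded ((hgeom.mul_left ((1 / 2) ^ N)).mul_right ‖u‖) fun k => ?_
      rw [norm_mul, Real.norm_of_nonneg (hb k).le, Real.norm_eq_abs]
      rcases lt_or_ge k N with hk | hk
      · rw [(hVz k t ht y hy (hN k hk)).2 u, abs_zero, mul_zero]; positivity
      · calc b k * |fderiv ℝ (V k) (y, t) (u, 0)| ≤ b k * (C k * ‖u‖) :=
              mul_le_mul_of_nonneg_left ((hVC k t ht y hy).2 u) (hb k).le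
          _ = b k * C k * ‖u‖ := by ring
          _ ≤ _ := mul_le_mul_of_nonneg_right ((hbC k).trans (hpow k hk)) (norm_nonneg _)
  have hdecr : ∀ t ∈ J, ∀ y, ‖y‖ < δ →
      HasSum (fun k => b k * -radialStep (r k) y) (fderiv ℝ S (y, t) (G y t, 1)) := by
    intro t ht y hy
    have := (hSum (y, t)).2 (G y t, 1)
    refine this.congr_fun ?_
    intro k
    rw [hVG k t ht y hy]
  have hq0 : ∀ k y, b k * -radialStep (r k) y ≤ (0 : ℝ) := fun k (y : E) =>
    mul_nonpos_of_nonneg_of_nonpos (hb k).le (neg_nonpos.2 (Real.smoothTransition.nonneg _))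
  let χ : ContDiffBump (0 : E) := ⟨R₀ / 2, R₀, by positivity, by linarith⟩
  set δ₁ := min δ (R₀ / 2) with hδ₁
  let W : E × ℝ → ℝ := fun p => χ p.1 * S p
  have hWS : ∀ t, ∀ y : E, ‖y‖ < δ₁ → W =ᶠ[𝓝 (y, t)] S := by
    intro t y hy
    have : (ball (0 : E) (R₀ / 2)) ×ˢ (univ : Set ℝ) ∈ 𝓝 (y, t) :=
      (isOpen_ball.prod isOpen_univ).mem_nhds
        ⟨by simpa using hy.trans_le (min_le_right _ _), mem_univ _⟩
    filter_upwards [this] with p hp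
    have : χ p.1 = 1 := χ.one_of_mem_closedBall (ball_subset_closedBall hp.1)
    simp [W, this]
  have hWS' : ∀ t, ∀ y : E, ‖y‖ < δ₁ → W (y, t) = S (y, t) ∧
      fderiv ℝ W (y, t) = fderiv ℝ S (y, t) := fun t y hy =>
    ⟨(hWS t y hy).self_of_nhds, (hWS t y hy).fderiv_eq⟩
  have hlt : ∀ y : E, ‖y‖ < δ₁ → ‖y‖ < δ := fun y hy => hy.trans_le (min_le_left _ _)
  refine ⟨W, (χ.contDiff.comp contDiff_fst).mul hS, fun p => mul_nonneg χ.nonneg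
    (tsum_nonneg fun k => mul_nonneg (hb k).le (hV0 k p)), fun p hp => ?_, δ₁,
    lt_min hδ (by positivity), (min_le_right _ _).trans (by linarith), ?_, ?_, ?_, ?_⟩
  · have : χ p.1 = 0 := χ.zero_of_le_dist (by simpa using hp)
    simp [W, this]
  · intro t ht y hy
    rw [(hWS' t y hy).2]
    exact (hdecr t ht y (hlt y hy)).nonpos fun k => hq0 k y
  · intro ρ hρ
    obtain ⟨k, hk⟩ := exists_nat_one_div_lt (show 0 < ρ / 4 by positivity)
    -- The step `k` equals one from `2 * r k` on, and the lower bound for `V k` holds from twice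
    -- that radius on.
    have hk' : 4 * r k ≤ ρ := by simp only [r]; linarith
    refine ⟨min (b k * c k) (b k), lt_min (mul_pos (hb k) (hc k)) (hb k), fun t ht y hy hρy => ?_⟩
    rw [(hWS' t y hy).1, (hWS' t y hy).2]
    constructor
    · refine (min_le_left _ _).trans ?_
      refine le_trans ?_ ((hSum (y, t)).1.le_tsum k
        fun j _ => mul_nonneg (hb j).le (hV0 j _))
      exact mul_le_mul_of_nonneg_left (hVc k t ht y (hlt y hy) (by linarith)) (hb k).le
    · have h1 := hdecr t ht y (hlt y hy)
      have h2 := (h1.neg).summable.le_tsum k fun j _ => neg_nonneg.2 (hq0 j y)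
      rw [h1.neg.tsum_eq, radialStep_of_ge (hr k) (by linarith [hr k])] at h2
      linarith [min_le_right (b k * c k) (b k)]
  · refine ⟨(1 / 2) ^ 0 * 2, fun t ht y hy => ?_⟩
    rw [(hWS' t y hy).1, (hWS' t y hy).2]
    exact hsmall 0 t ht y (hlt y hy) (by simp)
  · intro ε hε
    obtain ⟨N, hN⟩ := exists_pow_lt_of_lt_one (show 0 < ε / 2 by positivity)
      (show (1 / 2 : ℝ) < 1 by norm_num)
    have hev : ∀ᶠ x in 𝓝[>] (0 : ℝ), ∀ k ∈ Finset.range N, x < d k := by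
      rw [Filter.eventually_all_finset]
      intro k _
      exact mem_nhdsWithin_of_mem_nhds (Iio_mem_nhds (hd k))
    obtain ⟨δ', hδ', hpos⟩ := (hev.and self_mem_nhdsWithin).exists
    refine ⟨δ', hpos, fun t ht y hy hy' => ?_⟩
    rw [(hWS' t y hy).1, (hWS' t y hy).2]
    obtain ⟨h1, h2⟩ := hsmall N t ht y (hlt y hy) fun k hk =>
      hy'.trans (hδ' k (Finset.mem_range.2 hk))
    refine ⟨by linarith, fun u => (h2 u).trans ?_⟩
    gcongr
    linarith

end Core

/-! ### Reduction to a bounded globally defined field -/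

section Localization

open Metric NNReal

/-- The derivative bound holds only for times in `J`. Outside `J`, the field is to be cut off so
that only a compact set of times remains, where continuity bounds it. -/
theorem exists_time_cutoff {J : Set ℝ} (hJ : J = univ ∨ ∃ t₀ : ℝ, J = Ici t₀) :
    ∃ θ : ℝ → ℝ, ContDiff ℝ ∞ θ ∧ (∀ t, 0 ≤ θ t ∧ θ t ≤ 1) ∧ (∀ t ∈ J, θ t = 1) ∧
      ∃ K : Set ℝ, IsCompact K ∧ ∀ t, t ∉ J → t ∉ K → θ t = 0 := by
  rcases hJ with rfl | ⟨t₀, rfl⟩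
  · exact ⟨fun _ => 1, contDiff_const, fun t => by simp, fun _ _ => rfl, ∅, isCompact_empty,
      fun t ht => (ht (mem_univ t)).elim⟩
  · refine ⟨fun t => Real.smoothTransition (t - t₀ + 1),
      Real.smoothTransition.contDiff.comp ((contDiff_id.sub contDiff_const).add contDiff_const),
      fun t => ⟨Real.smoothTransition.nonneg _, Real.smoothTransition.le_one _⟩,
      fun t ht => Real.smoothTransition.one_of_one_le (by linarith [mem_Ici.1 ht]),
      Icc (t₀ - 1) t₀, isCompact_Icc, fun t ht ht' => Real.smoothTransition.zero_of_nonpos ?_⟩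
    rw [mem_Ici, not_le] at ht
    by_contra h
    exact ht' ⟨by linarith, ht.le⟩

variable {E : Type*} [NormedAddCommGroup E] [InnerProductSpace ℝ E]

theorem IsUniformlyStableFamily.congr {J : Set ℝ} (hJ : ∀ s ∈ J, ∀ t, s ≤ t → t ∈ J)
    {F G : E → ℝ → E} {δ R : ℝ} {Y : ℝ → E → ℝ → E} (hY : IsUniformlyStableFamily J F δ R Y)
    (h : ∀ t ∈ J, ∀ y, ‖y‖ < R → G y t = F y t) : IsUniformlyStableFamily J G δ R Y :=
  { hY with
    hasDerivWithinAt := fun s hs y hy τ hτ => by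
      rw [h _ (hJ s hs _ (by linarith)) _ (hY.norm_lt s hs y hy τ hτ)]
      exact hY.hasDerivWithinAt s hs y hy τ hτ }

/-- A smooth Lyapunov function near a uniformly asymptotically stable equilibrium of a
time-varying vector field with bounded derivative, defined near the origin of a vector space. -/
theorem exists_lyapunov_of_contDiffOn [FiniteDimensional ℝ E] {J : Set ℝ}
    (hJ : J = univ ∨ ∃ t₀ : ℝ, J = Ici t₀) {F : E → ℝ → E} {R : ℝ} (hR : 0 < R)
    (hF : ContDiffOn ℝ ∞ (fun p : E × ℝ => F p.1 p.2) (ball 0 R ×ˢ univ)) {L : ℝ}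
    (hL : ∀ t ∈ J, ∀ y ∈ ball (0 : E) R, ‖fderiv ℝ (fun y => F y t) y‖ ≤ L)
    (hF0 : ∀ t ∈ J, F 0 t = 0)
    {δ : ℝ} (hδ : 0 < δ) {Y : ℝ → E → ℝ → E} (hY : IsUniformlyStableFamily J F δ (R / 2) Y) :
    ∃ W : E × ℝ → ℝ, ContDiff ℝ ∞ W ∧ (∀ p, 0 ≤ W p) ∧ (∀ p, R / 2 ≤ ‖p.1‖ → W p = 0) ∧
      ∃ δ₁ > 0, δ₁ ≤ R / 2 ∧
      (∀ t ∈ J, ∀ y, ‖y‖ < δ₁ → fderiv ℝ W (y, t) (F y t, 1) ≤ 0) ∧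
      (∀ r > 0, ∃ c > 0, ∀ t ∈ J, ∀ y, ‖y‖ < δ₁ → r ≤ ‖y‖ →
        c ≤ W (y, t) ∧ fderiv ℝ W (y, t) (F y t, 1) ≤ -c) ∧
      (∃ C, ∀ t ∈ J, ∀ y, ‖y‖ < δ₁ →
        W (y, t) ≤ C ∧ ∀ u, |fderiv ℝ W (y, t) (u, 0)| ≤ C * ‖u‖) ∧
      ∀ ε > 0, ∃ δ' > 0, ∀ t ∈ J, ∀ y, ‖y‖ < δ₁ → ‖y‖ < δ' →
        W (y, t) ≤ ε ∧ ∀ u, |fderiv ℝ W (y, t) (u, 0)| ≤ ε * ‖u‖ := by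
  have hJ' : ∀ s ∈ J, ∀ t, s ≤ t → t ∈ J := by
    rcases hJ with rfl | ⟨t₀, rfl⟩
    · exact fun _ _ _ _ => mem_univ _
    · exact fun s hs t hst => le_trans hs hst
  have := FiniteDimensional.proper ℝ E
  obtain ⟨θ, hθ, hθ01, hθJ, K, hK, hθK⟩ := exists_time_cutoff hJ
  -- One on the ball of radius `R / 2`, which contains the trajectories; zero from `3 * R / 4` on,
  -- strictly inside the domain of smoothness.
  let χ : ContDiffBump (0 : E) := ⟨R / 2, 3 * R / 4, by positivity, by linarith⟩
  let G : E → ℝ → E := fun y t => (χ y * θ t) • F y t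
  have hopen : IsOpen (ball (0 : E) R ×ˢ (univ : Set ℝ)) := isOpen_ball.prod isOpen_univ
  have hG : ContDiff ℝ ∞ (fun p : E × ℝ => G p.1 p.2) := by
    refine contDiff_iff_contDiffAt.2 fun p => ?_
    by_cases hp : ‖p.1‖ < R
    · have h1 := hF.contDiffAt (hopen.mem_nhds ⟨by simpa using hp, mem_univ p.2⟩)
      exact ((χ.contDiff.comp contDiff_fst).mul (hθ.comp contDiff_snd)).contDiffAt.smul h1
    · have : {q : E × ℝ | 3 * R / 4 < ‖q.1‖} ∈ 𝓝 p :=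
        (isOpen_lt continuous_const (continuous_fst.norm)).mem_nhds (by
          simp only [mem_ofPred_eq]; linarith)
      refine (contDiffAt_const (c := (0 : E))).congr_of_eventuallyEq ?_
      filter_upwards [this] with q hq
      have : χ q.1 = 0 := χ.zero_of_le_dist (by rw [dist_zero_right]; exact le_of_lt hq)
      simp [G, this]
  have hslice : ∀ t, ∀ y ∈ ball (0 : E) R, DifferentiableAt ℝ (fun y => F y t) y := by
    intro t y hy
    have h1 := (hF.contDiffAt (hopen.mem_nhds (show (y, t) ∈ _ from ⟨hy, mem_univ t⟩))).differentiableAt (by simp)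
    exact DifferentiableAt.comp (g := fun p : E × ℝ => F p.1 p.2) (f := fun y => (y, t)) y h1
      (differentiableAt_id.prodMk (differentiableAt_const t))
  have hlip : ∀ t ∈ J, LipschitzOnWith L.toNNReal (fun y => F y t) (ball 0 R) := by
    intro t ht
    refine (convex_ball 0 R).lipschitzOnWith_of_nnnorm_fderiv_le (hslice t) fun y hy => ?_
    rw [← NNReal.coe_le_coe]
    exact (hL t ht y hy).trans (Real.le_coe_toNNReal L)
  -- Uniform in `t`, because the field vanishes at the origin and is uniformly Lipschitz.
  have hFJ : ∀ t ∈ J, ∀ y ∈ ball (0 : E) R, ‖F y t‖ ≤ L.toNNReal * R := by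
    intro t ht y hy
    have := (hlip t ht).dist_le_mul y hy 0 (by simpa using hR)
    rw [hF0 t ht, dist_zero_right, dist_zero_right] at this
    refine this.trans (mul_le_mul_of_nonneg_left ?_ (NNReal.coe_nonneg _))
    simpa using (mem_ball.1 hy).le
  obtain ⟨B, hB⟩ := ((isCompact_closedBall (0 : E) (3 * R / 4)).prod hK).exists_bound_of_continuousOn
    (hF.continuousOn.mono (prod_mono (closedBall_subset_ball (by linarith)) (subset_univ _)))
  have hGb : ∀ y t, ‖G y t‖ ≤ max (L.toNNReal * R) B := by
    intro y t
    have hc0 : 0 ≤ max (L.toNNReal * R) B := le_max_of_le_left (by positivity)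
    have hc : ‖χ y * θ t‖ ≤ 1 := by
      rw [Real.norm_of_nonneg (mul_nonneg χ.nonneg (hθ01 t).1)]
      exact mul_le_one₀ χ.le_one (hθ01 t).1 (hθ01 t).2
    simp only [G]
    rw [norm_smul]
    by_cases hy : ‖y‖ < 3 * R / 4
    · by_cases ht : t ∈ J
      · exact (mul_le_of_le_one_left (norm_nonneg _) hc).trans (le_max_of_le_left
          (hFJ t ht y (by rw [mem_ball, dist_zero_right]; linarith)))
      · by_cases htK : t ∈ K
        · exact (mul_le_of_le_one_left (norm_nonneg _) hc).trans (le_max_of_le_right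
            (hB (y, t) ⟨by rw [mem_closedBall, dist_zero_right]; exact hy.le, htK⟩))
        · simpa [hθK t ht htK] using hc0
    · have : χ y = 0 := χ.zero_of_le_dist (by rw [dist_zero_right]; exact not_lt.1 hy)
      simpa [this] using hc0
  have hGF : ∀ t ∈ J, ∀ y, ‖y‖ < R / 2 → G y t = F y t := by
    intro t ht y hy
    have : χ y = 1 := χ.one_of_mem_closedBall (by
      rw [mem_closedBall, dist_zero_right]; exact hy.le)
    simp [G, this, hθJ t ht]
  have hGL : ∀ t ∈ J, LipschitzOnWith L.toNNReal (fun y => G y t) (ball 0 (R / 2)) := by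
    intro t ht y hy z hz
    simp only [hGF t ht y (by simpa using hy), hGF t ht z (by simpa using hz)]
    exact hlip t ht (ball_subset_ball (by linarith) hy) (ball_subset_ball (by linarith) hz)
  obtain ⟨W, hW, hW0, hWR, δ₁, hδ₁, hδR, h1, h2, h3, h4⟩ :=
    exists_lyapunov_of_isUniformlyStableFamily hJ' hG hGb hδ (hY.congr hJ' hGF) hGL (half_pos hR)
  refine ⟨W, hW, hW0, hWR, δ₁, hδ₁, hδR, fun t ht y hy => ?_, fun r hr => ?_, h3, h4⟩
  · rw [← hGF t ht y (hy.trans_le hδR)]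
    exact h1 t ht y hy
  · obtain ⟨c, hc, h⟩ := h2 r hr
    refine ⟨c, hc, fun t ht y hy hry => ?_⟩
    rw [← hGF t ht y (hy.trans_le hδR)]
    exact h t ht y hy hry

/-- Gronwall's inequality along rays: a bound on the covariant derivative of a vector field which
vanishes at the origin yields bounds on the field and on its derivative. -/
theorem norm_fderiv_le_of_affine_bound {F : E → E} {R : ℝ}
    (hF : ∀ y ∈ ball (0 : E) R, DifferentiableAt ℝ F y) (hF0 : F 0 = 0) {A C : ℝ} (hA : 0 ≤ A)
    (hC : 0 ≤ C) (h : ∀ y ∈ ball (0 : E) R, ∀ u, ‖fderiv ℝ F y u‖ ≤ A * ‖u‖ + C * ‖u‖ * ‖F y‖) :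
    ∀ y ∈ ball (0 : E) R, ‖fderiv ℝ F y‖ ≤ A + C * gronwallBound 0 (C * R) (A * R) 1 := by
  -- Along `s ↦ F (s • y)` the derivative is at most `A * R + C * R * ‖F (s • y)‖`, and the initial
  -- value is zero.
  have key : ∀ y ∈ ball (0 : E) R, ‖F y‖ ≤ gronwallBound 0 (C * R) (A * R) 1 := by
    intro y hy
    have hyR : ‖y‖ < R := by simpa using hy
    have hmem : ∀ s ∈ Icc (0 : ℝ) 1, s • y ∈ ball (0 : E) R := fun s hs => by
      rw [mem_ball, dist_zero_right, norm_smul, Real.norm_of_nonneg hs.1]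
      exact (mul_le_of_le_one_left (norm_nonneg _) hs.2).trans_lt hyR
    have hd : ∀ s ∈ Icc (0 : ℝ) 1, HasDerivAt (fun s : ℝ => F (s • y)) (fderiv ℝ F (s • y) y) s :=
      fun s hs => by
        have h1 : HasDerivAt (fun s : ℝ => s • y) y s := by
          simpa using (hasDerivAt_id s).smul_const y
        exact (hF _ (hmem s hs)).hasFDerivAt.comp_hasDerivAt s h1
    have := norm_le_gronwallBound_of_norm_deriv_right_le (f := fun s : ℝ => F (s • y))
      (f' := fun s => fderiv ℝ F (s • y) y) (δ := 0) (K := C * R) (ε := A * R) (a := 0) (b := 1)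
      (fun s hs => (hd s hs).continuousAt.continuousWithinAt)
      (fun s hs => (hd s (Ico_subset_Icc_self hs)).hasDerivWithinAt)
      (by simp [hF0]) (fun s hs => by
        refine (h _ (hmem s (Ico_subset_Icc_self hs)) y).trans ?_
        rw [add_comm]
        gcongr) 1 (right_mem_Icc.2 zero_le_one)
    simpa using this
  intro y hy
  have hg : 0 ≤ gronwallBound 0 (C * R) (A * R) 1 := (norm_nonneg _).trans (key y hy)
  refine ContinuousLinearMap.opNorm_le_bound _ (by positivity) fun u => ?_
  calc _ ≤ _ := h y hy u
    _ ≤ A * ‖u‖ + C * ‖u‖ * gronwallBound 0 (C * R) (A * R) 1 := by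
      gcongr; exact key y hy
    _ = _ := by ring

end Localization

/-! ### Vector fields and the metric in a chart -/

section Coordinates

variable {n : ℕ} {M : Type*} [TopologicalSpace M] [ChartedSpace (EuclideanSpace ℝ (Fin n)) M]
  {e : OpenPartialHomeomorph M (EuclideanSpace ℝ (Fin n))}

theorem mdifferentiable_of_mem_maximalAtlas (he : e ∈ IsManifold.maximalAtlas (𝓡 n) ∞ M) :
    e.MDifferentiable (𝓡 n) (𝓡 n) :=
  ⟨(contMDiffOn_of_mem_maximalAtlas he).mdifferentiableOn (by simp),
    (contMDiffOn_symm_of_mem_maximalAtlas he).mdifferentiableOn (by simp)⟩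

/-- Expansion in the standard basis; it turns the double sums in the Sasaki norm back into
Riemannian norms. -/
theorem sum_coordMetric [RiemannianBundle (fun x : M => TangentSpace (𝓡 n) x)]
    (y u v : EuclideanSpace ℝ (Fin n)) :
    ∑ i, ∑ j, coordMetric e y i j * u i * v j =
      inner ℝ (mfderiv (𝓡 n) (𝓡 n) e.symm y u : TangentSpace (𝓡 n) (e.symm y))
        (mfderiv (𝓡 n) (𝓡 n) e.symm y v) := by
  have h : ∀ w : EuclideanSpace ℝ (Fin n),
      (mfderiv (𝓡 n) (𝓡 n) e.symm y w : TangentSpace (𝓡 n) (e.symm y)) =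
      ∑ i, w i • (mfderiv (𝓡 n) (𝓡 n) e.symm y (EuclideanSpace.single i (1 : ℝ)) :
        TangentSpace (𝓡 n) (e.symm y)) := by
    intro w
    let A : EuclideanSpace ℝ (Fin n) →L[ℝ] TangentSpace (𝓡 n) (e.symm y) :=
      mfderiv (𝓡 n) (𝓡 n) e.symm y
    have hw : w = ∑ i, w i • EuclideanSpace.single i (1 : ℝ) := by
      simpa using ((EuclideanSpace.basisFun (Fin n) ℝ).sum_repr w).symm
    have h1 : A w = ∑ i, w i • A (EuclideanSpace.single i (1 : ℝ)) := by
      conv_lhs => rw [hw, map_sum]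
      exact Finset.sum_congr rfl fun i _ => map_smul A _ _
    exact h1
  rw [h u, h v, sum_inner]
  refine Finset.sum_congr rfl fun i _ => ?_
  rw [inner_sum]
  refine Finset.sum_congr rfl fun j _ => ?_
  rw [inner_smul_left, inner_smul_right]
  simp only [coordMetric, Matrix.of_apply, conj_trivial]
  ring

/-- The coordinate expression of a time-varying vector field. -/
noncomputable def coordField (e : OpenPartialHomeomorph M (EuclideanSpace ℝ (Fin n)))
    (f : (x : M) → ℝ → TangentSpace (𝓡 n) x) (y : EuclideanSpace ℝ (Fin n)) (t : ℝ) :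
    EuclideanSpace ℝ (Fin n) :=
  mfderiv (𝓡 n) (𝓡 n) e (e.symm y) (f (e.symm y) t)

theorem coordField_apply_chart {f : (x : M) → ℝ → TangentSpace (𝓡 n) x} {x : M}
    (hx : x ∈ e.source) (t : ℝ) :
    coordField e f (e x) t = mfderiv (𝓡 n) (𝓡 n) e x (f x t) := by
  simp only [coordField]
  rw [e.left_inv hx]

variable [IsManifold (𝓡 n) ∞ M]

theorem contMDiffOn_tangentCoord (he : e ∈ IsManifold.maximalAtlas (𝓡 n) ∞ M) :
    ContMDiffOn (𝓡 n).tangent 𝓘(ℝ, EuclideanSpace ℝ (Fin n) × EuclideanSpace ℝ (Fin n)) ∞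
      (tangentCoord e)
      (π (EuclideanSpace ℝ (Fin n)) (TangentSpace (𝓡 n) (M := M)) ⁻¹' e.source) := by
  have h1 : ContMDiffOn (𝓡 n).tangent 𝓘(ℝ, EuclideanSpace ℝ (Fin n)) ∞
      (fun p : TangentBundle (𝓡 n) M => e p.1)
      (π (EuclideanSpace ℝ (Fin n)) (TangentSpace (𝓡 n) (M := M)) ⁻¹' e.source) :=
    (contMDiffOn_of_mem_maximalAtlas he).comp
      (contMDiff_proj (TangentSpace (𝓡 n) (M := M))).contMDiffOn (fun x hx => hx)
  have h2 := (contMDiffOn_of_mem_maximalAtlas he).contMDiffOn_tangentMapWithin (m := ∞) (by simp)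
    e.open_source.uniqueMDiffOn
  have h3 := (contMDiff_snd_tangentBundle_modelSpace (n := ∞)
    (EuclideanSpace ℝ (Fin n)) (𝓡 n)).comp_contMDiffOn h2
  refine h1.prodMk_space (h3.congr fun p hp => ?_)
  simp only [Function.comp, tangentMapWithin]
  rw [mfderivWithin_of_isOpen e.open_source hp]

theorem contDiffOn_coordField (he : e ∈ IsManifold.maximalAtlas (𝓡 n) ∞ M)
    {f : (x : M) → ℝ → TangentSpace (𝓡 n) x} (hf : IsSmoothTimeVaryingField f) :
    ContDiffOn ℝ ∞ (fun p : EuclideanSpace ℝ (Fin n) × ℝ => coordField e f p.1 p.2)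
      (e.target ×ˢ univ) := by
  rw [← contMDiffOn_iff_contDiffOn, modelWithCornersSelf_prod, ← chartedSpaceSelf_prod]
  have h1 : ContMDiffOn ((𝓡 n).prod 𝓘(ℝ, ℝ)) ((𝓡 n).prod 𝓘(ℝ, ℝ)) ∞
      (fun p : EuclideanSpace ℝ (Fin n) × ℝ => (e.symm p.1, p.2)) (e.target ×ˢ univ) :=
    ((contMDiffOn_symm_of_mem_maximalAtlas he).comp contMDiff_fst.contMDiffOn
      (fun p hp => hp.1)).prodMk contMDiff_snd.contMDiffOn
  have h2 := hf.comp_contMDiffOn h1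
  have h3 := (contMDiffOn_tangentCoord he).comp h2 (fun p hp => e.map_target hp.1)
  exact contDiff_snd.contMDiff.comp_contMDiffOn h3


/-- The pushforward of a vector field in the coordinates of the tangent bundle. -/
theorem mfderiv_tangentCoord_apply (he : e ∈ IsManifold.maximalAtlas (𝓡 n) ∞ M)
    {f : (x : M) → ℝ → TangentSpace (𝓡 n) x} (hf : IsSmoothTimeVaryingField f) (t : ℝ)
    {y : EuclideanSpace ℝ (Fin n)} (hy : y ∈ e.target) (u : EuclideanSpace ℝ (Fin n)) :
    mfderiv (𝓡 n).tangent 𝓘(ℝ, EuclideanSpace ℝ (Fin n) × EuclideanSpace ℝ (Fin n))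
        (tangentCoord e) ⟨e.symm y, f (e.symm y) t⟩
        (mfderiv (𝓡 n) (𝓡 n).tangent (fun x => (⟨x, f x t⟩ : TangentBundle (𝓡 n) M)) (e.symm y)
          (mfderiv (𝓡 n) (𝓡 n) e.symm y u)) =
      (u, fderiv ℝ (fun y => coordField e f y t) y u) := by
  have hx : e.symm y ∈ e.source := e.map_target hy
  have h1 : MDifferentiableAt (𝓡 n).tangent
      𝓘(ℝ, EuclideanSpace ℝ (Fin n) × EuclideanSpace ℝ (Fin n)) (tangentCoord e)
      (⟨e.symm y, f (e.symm y) t⟩ : TangentBundle (𝓡 n) M) :=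
    ((contMDiffOn_tangentCoord he).contMDiffAt ((e.open_source.preimage
      (FiberBundle.continuous_proj _ _)).mem_nhds hx)).mdifferentiableAt (by simp)
  have h2 : MDifferentiableAt (𝓡 n) (𝓡 n).tangent
      (fun x => (⟨x, f x t⟩ : TangentBundle (𝓡 n) M)) (e.symm y) := by
    have h := hf.comp (contMDiff_id.prodMk (contMDiff_const (c := t)) :
      ContMDiff (𝓡 n) ((𝓡 n).prod 𝓘(ℝ, ℝ)) ∞ (fun x : M => (x, t)))
    exact (h (e.symm y)).mdifferentiableAt (by simp)
  have h3 : MDifferentiableAt (𝓡 n) (𝓡 n) e.symm y :=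
    (mdifferentiable_of_mem_maximalAtlas he).mdifferentiableAt_symm hy
  have h12 := MDifferentiableAt.comp (e.symm y) h1 h2
  have hc : mfderiv (𝓡 n) 𝓘(ℝ, EuclideanSpace ℝ (Fin n) × EuclideanSpace ℝ (Fin n))
      (fun y => tangentCoord e ⟨e.symm y, f (e.symm y) t⟩) y u =
      mfderiv (𝓡 n).tangent 𝓘(ℝ, EuclideanSpace ℝ (Fin n) × EuclideanSpace ℝ (Fin n))
        (tangentCoord e) ⟨e.symm y, f (e.symm y) t⟩
        (mfderiv (𝓡 n) (𝓡 n).tangent (fun x => (⟨x, f x t⟩ : TangentBundle (𝓡 n) M)) (e.symm y)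
          (mfderiv (𝓡 n) (𝓡 n) e.symm y u)) := by
    rw [show (fun y => tangentCoord e ⟨e.symm y, f (e.symm y) t⟩) =
      (tangentCoord e ∘ fun x => (⟨x, f x t⟩ : TangentBundle (𝓡 n) M)) ∘ e.symm from rfl,
      mfderiv_comp y h12 h3, mfderiv_comp (e.symm y) h1 h2]
    rfl
  rw [← hc]
  -- In induced coordinates the section is the graph `y ↦ (y, F y)` of its coordinate expression.
  have hev : (fun y => tangentCoord e ⟨e.symm y, f (e.symm y) t⟩) =ᶠ[𝓝 y]
      fun y => (y, coordField e f y t) := by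
    filter_upwards [e.open_target.mem_nhds hy] with z hz
    simp only [tangentCoord, coordField]
    rw [e.right_inv hz]
  rw [hev.mfderiv_eq, mfderiv_eq_fderiv]
  have hd : DifferentiableAt ℝ (fun y => coordField e f y t) y := by
    have h := ((contDiffOn_coordField he hf).contDiffAt ((e.open_target.prod isOpen_univ).mem_nhds
      (show (y, t) ∈ _ from ⟨hy, mem_univ t⟩))).differentiableAt (by simp)
    exact DifferentiableAt.comp (g := fun p : EuclideanSpace ℝ (Fin n) × ℝ =>
      coordField e f p.1 p.2) (f := fun y => (y, t)) y h
      (differentiableAt_id.prodMk (differentiableAt_const t))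
  have := ((hasFDerivAt_id y).prodMk hd.hasFDerivAt).fderiv
  exact congrArg (fun A => A u) this

variable [RiemannianBundle (fun x : M => TangentSpace (𝓡 n) x)]
  [IsContMDiffRiemannianBundle (𝓡 n) ∞ (EuclideanSpace ℝ (Fin n))
      (fun x : M => TangentSpace (𝓡 n) x)]

/-- The coordinate vector fields are images of constant fields under the smooth tangent map of
`e.symm`, and inner products of smooth sections are smooth. -/
theorem contDiffOn_coordMetric (he : e ∈ IsManifold.maximalAtlas (𝓡 n) ∞ M) (i j : Fin n) :
    ContDiffOn ℝ ∞ (fun y => coordMetric e y i j) e.target := by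
  have h2 := (contMDiffOn_symm_of_mem_maximalAtlas he).contMDiffOn_tangentMapWithin (m := ∞)
    (by simp) e.open_target.uniqueMDiffOn
  have key : ∀ v : EuclideanSpace ℝ (Fin n), ContMDiffOn (𝓡 n) (𝓡 n).tangent ∞
      (fun y => (⟨e.symm y, mfderiv (𝓡 n) (𝓡 n) e.symm y v⟩ : TangentBundle (𝓡 n) M))
      e.target := by
    intro v
    have h3 : ContMDiff (𝓡 n) (𝓡 n).tangent ∞ (fun y => (⟨y, v⟩ :
        TangentBundle (𝓡 n) (EuclideanSpace ℝ (Fin n)))) :=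
      contMDiff_vectorSpace_iff_contDiff.2 contDiff_const
    refine (h2.comp h3.contMDiffOn (fun y hy => hy)).congr fun y hy => ?_
    simp only [Function.comp, tangentMapWithin]
    rw [mfderivWithin_of_isOpen e.open_target hy]
  exact ((key _).inner_bundle (key _)).contDiffOn

end Coordinates

/-! ### From the Sasaki norm to Euclidean bounds on compact sets -/

section MetricBounds

theorem EuclideanSpace.norm_le_sum_abs {n : ℕ} (x : EuclideanSpace ℝ (Fin n)) :
    ‖x‖ ≤ ∑ i, |x i| := by
  have hx : x = ∑ i, x i • EuclideanSpace.single i (1 : ℝ) := by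
    simpa using ((EuclideanSpace.basisFun (Fin n) ℝ).sum_repr x).symm
  conv_lhs => rw [hx]
  refine (norm_sum_le _ _).trans (Finset.sum_le_sum fun i _ => ?_)
  simp [norm_smul]

theorem EuclideanSpace.abs_apply_le_norm {n : ℕ} (x : EuclideanSpace ℝ (Fin n)) (i : Fin n) :
    |x i| ≤ ‖x‖ := PiLp.norm_apply_le x i

variable {n : ℕ} {M : Type*} [TopologicalSpace M] [ChartedSpace (EuclideanSpace ℝ (Fin n)) M]
  [IsManifold (𝓡 n) ∞ M]
  [RiemannianBundle (fun x : M => TangentSpace (𝓡 n) x)]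
  [IsContMDiffRiemannianBundle (𝓡 n) ∞ (EuclideanSpace ℝ (Fin n))
      (fun x : M => TangentSpace (𝓡 n) x)]
  {e : OpenPartialHomeomorph M (EuclideanSpace ℝ (Fin n))}

/-- The Riemannian norm is continuous and positive on the compact product of `K` with the unit
sphere; homogeneity does the rest. -/
theorem exists_norm_mfderiv_symm_bounds (he : e ∈ IsManifold.maximalAtlas (𝓡 n) ∞ M)
    {K : Set (EuclideanSpace ℝ (Fin n))} (hK : IsCompact K) (hKe : K ⊆ e.target) :
    ∃ a > 0, ∃ b > 0, ∀ y ∈ K, ∀ u : EuclideanSpace ℝ (Fin n),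
      a * ‖u‖ ≤ ‖(mfderiv (𝓡 n) (𝓡 n) e.symm y u : TangentSpace (𝓡 n) (e.symm y))‖ ∧
      ‖(mfderiv (𝓡 n) (𝓡 n) e.symm y u : TangentSpace (𝓡 n) (e.symm y))‖ ≤ b * ‖u‖ := by
  let N : EuclideanSpace ℝ (Fin n) × EuclideanSpace ℝ (Fin n) → ℝ := fun p =>
    ‖(mfderiv (𝓡 n) (𝓡 n) e.symm p.1 p.2 : TangentSpace (𝓡 n) (e.symm p.1))‖
  have hN2 : ∀ p, N p = √(∑ i, ∑ j, coordMetric e p.1 i j * p.2 i * p.2 j) := fun p => by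
    rw [sum_coordMetric, real_inner_self_eq_norm_sq, Real.sqrt_sq (norm_nonneg _)]
  have hNc : ContinuousOn N (K ×ˢ Metric.sphere 0 1) := by
    have hu : ∀ i, Continuous fun p : EuclideanSpace ℝ (Fin n) × EuclideanSpace ℝ (Fin n) =>
        p.2 i := fun i => (EuclideanSpace.proj (𝕜 := ℝ) i).continuous.comp continuous_snd
    rw [show N = fun p => √(∑ i, ∑ j, coordMetric e p.1 i j * p.2 i * p.2 j) from funext hN2]
    refine ContinuousOn.sqrt (continuousOn_finsetSum _ fun i _ =>
      continuousOn_finsetSum _ fun j _ => ContinuousOn.mul (ContinuousOn.mul ?_ ?_) ?_)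
    · exact (contDiffOn_coordMetric he i j).continuousOn.comp continuousOn_fst
        (fun p hp => hKe hp.1)
    · exact (hu i).continuousOn
    · exact (hu j).continuousOn
  have hinj : ∀ y ∈ K, ∀ u : EuclideanSpace ℝ (Fin n), u ≠ 0 → 0 < N (y, u) := by
    intro y hy u hu
    refine norm_pos_iff.2 fun h => hu ?_
    exact (mdifferentiable_of_mem_maximalAtlas he).symm.mfderiv_injective (hKe hy)
      (h.trans (map_zero (mfderiv (𝓡 n) (𝓡 n) e.symm y)).symm)
  have hcompact : IsCompact (K ×ˢ Metric.sphere (0 : EuclideanSpace ℝ (Fin n)) 1) :=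
    hK.prod (isCompact_sphere _ _)
  have hne : ∀ p ∈ K ×ˢ Metric.sphere (0 : EuclideanSpace ℝ (Fin n)) 1, 0 < N p := fun p hp =>
    hinj p.1 hp.1 p.2 (ne_zero_of_mem_unit_sphere ⟨p.2, hp.2⟩)
  obtain ⟨B, hB⟩ := hcompact.exists_bound_of_continuousOn hNc
  -- Bounding the inverse, instead of taking a minimum, also covers an empty product.
  obtain ⟨B', hB'⟩ := hcompact.exists_bound_of_continuousOn (f := fun p => (N p)⁻¹)
    (hNc.inv₀ fun p hp => (hne p hp).ne')
  refine ⟨(|B'| + 1)⁻¹, by positivity, |B| + 1, by positivity, fun y hy u => ?_⟩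
  by_cases hu : u = 0
  · subst hu
    have h0 : ‖(mfderiv (𝓡 n) (𝓡 n) e.symm y (0 : EuclideanSpace ℝ (Fin n)) :
        TangentSpace (𝓡 n) (e.symm y))‖ = 0 :=
      (congrArg (fun X : TangentSpace (𝓡 n) (e.symm y) => ‖X‖)
        (map_zero (mfderiv (𝓡 n) (𝓡 n) e.symm y))).trans norm_zero
    rw [h0, norm_zero]
    simp
  have hu' : 0 < ‖u‖ := norm_pos_iff.2 hu
  have hmem : (y, ‖u‖⁻¹ • u) ∈ K ×ˢ Metric.sphere (0 : EuclideanSpace ℝ (Fin n)) 1 := by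
    refine ⟨hy, ?_⟩
    rw [mem_sphere_zero_iff_norm, norm_smul, norm_inv, norm_norm, inv_mul_cancel₀ hu'.ne']
  have hscale : ‖(mfderiv (𝓡 n) (𝓡 n) e.symm y u : TangentSpace (𝓡 n) (e.symm y))‖ =
      N (y, ‖u‖⁻¹ • u) * ‖u‖ := by
    have h1 : N (y, ‖u‖⁻¹ • u) =
        ‖u‖⁻¹ * ‖(mfderiv (𝓡 n) (𝓡 n) e.symm y u : TangentSpace (𝓡 n) (e.symm y))‖ := by
      simp only [N]
      have := map_smul (mfderiv (𝓡 n) (𝓡 n) e.symm y) ‖u‖⁻¹ u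
      refine (congrArg (fun X : TangentSpace (𝓡 n) (e.symm y) => ‖X‖) this).trans ?_
      simp only [norm_smul, norm_inv, norm_norm]
      rfl
    rw [h1]
    field_simp
  rw [hscale]
  have h1 := hB _ hmem
  have h2 := hB' _ hmem
  rw [Real.norm_of_nonneg (hne _ hmem).le] at h1
  rw [Real.norm_of_nonneg (inv_pos.2 (hne _ hmem)).le] at h2
  constructor
  · refine mul_le_mul_of_nonneg_right (inv_le_of_inv_le₀ (hne _ hmem) ?_) hu'.le
    linarith [le_abs_self B']
  · refine mul_le_mul_of_nonneg_right ?_ hu'.le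
    linarith [le_abs_self B]

/-- The point is that the Gram matrix is invertible: a null vector would have an image of norm zero,
but the derivative of `e.symm` is injective. -/
theorem continuousOn_christoffel (he : e ∈ IsManifold.maximalAtlas (𝓡 n) ∞ M) (i j k : Fin n) :
    ContinuousOn (fun y => christoffel e y i j k) e.target := by
  have hg : ContinuousOn (coordMetric e) e.target :=
    continuousOn_pi.2 fun i => continuousOn_pi.2 fun j => (contDiffOn_coordMetric he i j).continuousOn
  have hdet : ∀ y ∈ e.target, (coordMetric e y).det ≠ 0 := by
    intro y hy h0
    obtain ⟨v, hv, hv0⟩ := Matrix.exists_mulVec_eq_zero_iff.2 h0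
    have h1 := sum_coordMetric (e := e) y (WithLp.toLp 2 v) (WithLp.toLp 2 v)
    have h2 : ∑ i, ∑ j, coordMetric e y i j * v i * v j = 0 := by
      refine Finset.sum_eq_zero fun i _ => ?_
      have := congrFun hv0 i
      simp only [Matrix.mulVec, dotProduct, Pi.zero_apply] at this
      calc ∑ j, coordMetric e y i j * v i * v j = v i * ∑ j, coordMetric e y i j * v j := by
            rw [Finset.mul_sum]; exact Finset.sum_congr rfl fun j _ => by ring
        _ = 0 := by rw [this, mul_zero]
    rw [show (∑ i, ∑ j, coordMetric e y i j * (WithLp.toLp 2 v : EuclideanSpace ℝ (Fin n)) i *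
      (WithLp.toLp 2 v : EuclideanSpace ℝ (Fin n)) j) = 0 from h2] at h1
    have h3 := inner_self_eq_zero.1 h1.symm
    have h4 := (mdifferentiable_of_mem_maximalAtlas he).symm.mfderiv_injective hy
      (h3.trans (map_zero (mfderiv (𝓡 n) (𝓡 n) e.symm y)).symm)
    exact hv (congrArg (WithLp.ofLp) h4)
  have hinv : ∀ i l, ContinuousOn (fun y => (coordMetric e y)⁻¹ i l) e.target := by
    intro i l
    have h1 : ContinuousOn (fun y => (coordMetric e y).det⁻¹ * (coordMetric e y).adjugate i l)
        e.target := by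
      refine ContinuousOn.mul (ContinuousOn.inv₀ ?_ hdet) ?_
      · exact (Continuous.matrix_det continuous_id).comp_continuousOn hg
      · exact ((Continuous.matrix_adjugate continuous_id).matrix_elem i l).comp_continuousOn hg
    refine h1.congr fun y _ => ?_
    simp [Matrix.inv_def, Ring.inverse_eq_inv']
  have hder : ∀ i j k, ContinuousOn (fun y => coordMetricDeriv e y i j k) e.target := fun i j k =>
    ((contDiffOn_coordMetric he i j).continuousOn_fderiv_of_isOpen e.open_target
      (by simp)).clm_apply continuousOn_const
  refine continuousOn_const.mul (continuousOn_finsetSum _ fun l _ => (hinv i l).mul ?_)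
  exact ((hder _ _ _).add (hder _ _ _)).sub (hder _ _ _)

/-- A bound on the pushforward of the vector field in the Sasaki metric bounds the derivative of
its coordinate expression. -/
theorem exists_norm_fderiv_coordField_le (he : e ∈ IsManifold.maximalAtlas (𝓡 n) ∞ M)
    {f : (x : M) → ℝ → TangentSpace (𝓡 n) x} (hf : IsSmoothTimeVaryingField f) {J : Set ℝ}
    (hTf : HasBoundedPushforward J e f)
    {K : Set (EuclideanSpace ℝ (Fin n))} (hK : IsCompact K) (hKe : K ⊆ e.target) :
    ∃ A ≥ 0, ∃ C ≥ 0, ∀ t ∈ J, ∀ y ∈ K, ∀ u : EuclideanSpace ℝ (Fin n),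
      ‖fderiv ℝ (fun y => coordField e f y t) y u‖ ≤
        A * ‖u‖ + C * ‖u‖ * ‖coordField e f y t‖ := by
  obtain ⟨a, ha, b, hb, hab⟩ := exists_norm_mfderiv_symm_bounds he hK hKe
  have hΓ : ∀ i j k, ∃ B, ∀ y ∈ K, |christoffel e y i j k| ≤ B := fun i j k =>
    hK.exists_bound_of_continuousOn ((continuousOn_christoffel he i j k).mono hKe)
  choose B hB using hΓ
  obtain ⟨C₀, hC₀⟩ := hTf
  refine ⟨a⁻¹ * (|C₀| * b), by positivity, ∑ i, ∑ j, ∑ k, |B i j k|, by positivity,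
    fun t ht y hy u => ?_⟩
  have hyt := hKe hy
  set v := coordField e f y t with hv
  set D := fderiv ℝ (fun y => coordField e f y t) y u with hD
  let γ : EuclideanSpace ℝ (Fin n) :=
    WithLp.toLp 2 fun i => ∑ j, ∑ k, christoffel e y i j k * u j * v k
  have hγ : ‖γ‖ ≤ (∑ i, ∑ j, ∑ k, |B i j k|) * ‖u‖ * ‖v‖ := by
    refine (EuclideanSpace.norm_le_sum_abs γ).trans ?_
    rw [mul_assoc, Finset.sum_mul]
    refine Finset.sum_le_sum fun i _ => ?_
    rw [Finset.sum_mul]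
    change |∑ j, ∑ k, christoffel e y i j k * u j * v k| ≤ _
    refine le_trans (Finset.abs_sum_le_sum_abs _ _) ?_
    refine Finset.sum_le_sum fun j _ => ?_
    rw [Finset.sum_mul]
    refine le_trans (Finset.abs_sum_le_sum_abs _ _) ?_
    refine Finset.sum_le_sum fun k _ => ?_
    rw [abs_mul, abs_mul, mul_assoc]
    refine mul_le_mul ((hB i j k y hy).trans (le_abs_self _)) (mul_le_mul
      (EuclideanSpace.abs_apply_le_norm u j) (EuclideanSpace.abs_apply_le_norm v k)
      (abs_nonneg _) (norm_nonneg _)) (by positivity) (abs_nonneg _)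
  have h1 := hC₀ t ht (e.symm y) (e.map_target hyt) (mfderiv (𝓡 n) (𝓡 n) e.symm y u)
  have h2 : sasakiNorm e ⟨e.symm y, f (e.symm y) t⟩
      (mfderiv (𝓡 n) (𝓡 n).tangent (fun x => (⟨x, f x t⟩ : TangentBundle (𝓡 n) M)) (e.symm y)
          (mfderiv (𝓡 n) (𝓡 n) e.symm y u)) =
      √((∑ i, ∑ j, coordMetric e y i j * u i * u j) +
        ∑ i, ∑ j, coordMetric e y i j * (D + γ) i * (D + γ) j) := by
    have h3 := mfderiv_tangentCoord_apply he hf t hyt u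
    simp only [sasakiNorm]
    rw [h3, e.right_inv hyt]
    rfl
  rw [h2, sum_coordMetric, sum_coordMetric, real_inner_self_eq_norm_sq,
    real_inner_self_eq_norm_sq] at h1
  -- The connector part alone is at most the full Sasaki norm. In coordinates it is `D + γ`, with
  -- `γ` the Christoffel term.
  have h4 : ‖(mfderiv (𝓡 n) (𝓡 n) e.symm y (D + γ) : TangentSpace (𝓡 n) (e.symm y))‖ ≤
      |C₀| * (b * ‖u‖) := by
    refine (Real.le_sqrt_of_sq_le ?_).trans (h1.trans ?_)
    · exact le_add_of_nonneg_left (sq_nonneg _)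
    · exact mul_le_mul (le_abs_self _) (hab y hy u).2 (norm_nonneg _) (abs_nonneg _)
  have h5 := (hab y hy (D + γ)).1.trans h4
  have h6 : ‖D + γ‖ ≤ a⁻¹ * (|C₀| * b) * ‖u‖ := by
    rw [mul_assoc, le_inv_mul_iff₀ ha, mul_assoc]
    exact h5
  calc ‖D‖ = ‖(D + γ) - γ‖ := by rw [add_sub_cancel_right]
    _ ≤ ‖D + γ‖ + ‖γ‖ := norm_sub_le _ _
    _ ≤ _ := add_le_add h6 hγ

end MetricBounds

/-! ### Stability and attractivity of trajectories in the chart -/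

section Chart

variable {n : ℕ} {M : Type*} [MetricSpace M]
  {e : OpenPartialHomeomorph M (EuclideanSpace ℝ (Fin n))} {xbar : M}

theorem exists_dist_lt_imp_norm_chart_lt (hxe : xbar ∈ e.source) {ε : ℝ} (hε : 0 < ε) :
    ∃ η > 0, ∀ x, dist x xbar < η → x ∈ e.source ∧ ‖e x - e xbar‖ < ε := by
  have h1 : ∀ᶠ x in 𝓝 xbar, x ∈ e.source ∧ ‖e x - e xbar‖ < ε := by
    filter_upwards [e.open_source.mem_nhds hxe,
      (e.continuousAt hxe).eventually (Metric.ball_mem_nhds _ hε)] with x hx hx'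
    exact ⟨hx, by simpa [dist_eq_norm] using hx'⟩
  exact Metric.eventually_nhds_iff.1 h1

theorem exists_norm_lt_imp_dist_symm_lt (hxe : xbar ∈ e.source) {ε : ℝ} (hε : 0 < ε) :
    ∃ η > 0, ∀ y, ‖y‖ < η → e xbar + y ∈ e.target ∧ dist (e.symm (e xbar + y)) xbar < ε := by
  have h1 : ∀ᶠ z in 𝓝 (e xbar), z ∈ e.target ∧ dist (e.symm z) xbar < ε := by
    have h2 := (e.continuousAt_symm (e.map_source hxe)).eventually
      (Metric.ball_mem_nhds (e.symm (e xbar)) hε)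
    rw [e.left_inv hxe] at h2
    filter_upwards [e.open_target.mem_nhds (e.map_source hxe), h2] with z hz hz'
    exact ⟨hz, hz'⟩
  obtain ⟨η, hη, h⟩ := Metric.eventually_nhds_iff.1 h1
  exact ⟨η, hη, fun y hy => h (by simpa [dist_eq_norm] using hy)⟩

variable {J : Set ℝ} {Φ : ℝ → ℝ → M → M}

/-- Uniform stability: `β r τ ≤ β r 0`, and `β · 0` is continuous at zero with value zero. -/
theorem IsClassKL.exists_forall_dist_lt {b : ℝ≥0∞} {β : ℝ → ℝ → ℝ} (hβ : IsClassKL b β)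
    (hxe : xbar ∈ e.source) (hb : ∀ x ∈ e.source, edist x xbar < b)
    (hbound : ∀ s ∈ J, ∀ x₀ ∈ e.source, ∀ t, s ≤ t →
      dist (Φ t s x₀) xbar ≤ β (dist x₀ xbar) (t - s)) {ε : ℝ} (hε : 0 < ε) :
    ∃ η > 0, ∀ s ∈ J, ∀ x ∈ e.source, dist x xbar < η → ∀ t, s ≤ t →
      dist (Φ t s x) xbar < ε := by
  have hdom : ∀ x ∈ e.source, dist x xbar ∈ comparisonDomain b := fun x hx =>
    ⟨dist_nonneg, by rw [← edist_dist]; exact hb x hx⟩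
  have h0 : (0 : ℝ) ∈ comparisonDomain b := by simpa using hdom xbar hxe
  obtain ⟨hc, -, hz⟩ := hβ.2.1 0 le_rfl
  replace hz : β 0 0 = 0 := hz
  obtain ⟨η, hη, h⟩ := Metric.continuousWithinAt_iff.1 (hc 0 h0) ε hε
  refine ⟨η, hη, fun s hs x hx hxη t hst => ?_⟩
  have h1 := h (hdom x hx) (by rwa [Real.dist_eq, sub_zero, abs_of_nonneg dist_nonneg])
  rw [hz, Real.dist_eq, sub_zero] at h1
  have h2 := (hβ.2.2 _ (hdom x hx)).1 (mem_Ici.2 le_rfl) (mem_Ici.2 (sub_nonneg.2 hst))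
    (sub_nonneg.2 hst)
  exact ((hbound s hs x hx t hst).trans h2).trans_lt ((le_abs_self _).trans_lt h1)

/-- Uniform attractivity: monotonicity in the first variable replaces all distances below `η` by the
single value `η < b`, and `β η` tends to zero. -/
theorem IsClassKL.exists_forall_dist_lt_of_le {b : ℝ≥0∞} {β : ℝ → ℝ → ℝ} (hβ : IsClassKL b β)
    (hxe : xbar ∈ e.source) (hb : ∀ x ∈ e.source, edist x xbar < b)
    (hbound : ∀ s ∈ J, ∀ x₀ ∈ e.source, ∀ t, s ≤ t →
      dist (Φ t s x₀) xbar ≤ β (dist x₀ xbar) (t - s)) :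
    ∃ η > 0, ∀ ε > 0, ∃ T : ℝ, ∀ s ∈ J, ∀ x ∈ e.source, dist x xbar < η → ∀ t, s ≤ t →
      T ≤ t - s → dist (Φ t s x) xbar < ε := by
  have hdom : ∀ x ∈ e.source, dist x xbar ∈ comparisonDomain b := fun x hx =>
    ⟨dist_nonneg, by rw [← edist_dist]; exact hb x hx⟩
  have hb0 : 0 < b := by simpa using hb xbar hxe
  obtain ⟨η, hη0, hηb⟩ := ENNReal.lt_iff_exists_nnreal_btwn.1 hb0
  have hη : (0 : ℝ) < η := by exact_mod_cast hη0
  have hηd : (η : ℝ) ∈ comparisonDomain b := ⟨hη.le, by simpa using hηb⟩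
  refine ⟨η, hη, fun ε hε => ?_⟩
  obtain ⟨T, hT⟩ := eventually_atTop.1 ((hβ.2.2 _ hηd).2.eventually (gt_mem_nhds hε))
  refine ⟨T, fun s hs x hx hxη t hst hTt => ?_⟩
  have h1 := (hβ.2.1 (t - s) (sub_nonneg.2 hst)).2.1 (hdom x hx) hηd hxη
  exact ((hbound s hs x hx t hst).trans h1.le).trans_lt (hT _ hTt)

variable [ChartedSpace (EuclideanSpace ℝ (Fin n)) M]

section Flow

variable {f : (x : M) → ℝ → TangentSpace (𝓡 n) x}

theorem IsFlow.hasDerivWithinAt_chart (hΦ : IsFlow J f Φ)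
    (he : e ∈ IsManifold.maximalAtlas (𝓡 n) ∞ M) {s t : ℝ} (hs : s ∈ J) (hst : s ≤ t) {x : M}
    (hx : Φ t s x ∈ e.source) :
    HasDerivWithinAt (fun τ => e (Φ τ s x)) (coordField e f (e (Φ t s x)) t) (Ici s) t := by
  have h1 := ((mdifferentiable_of_mem_maximalAtlas he).mdifferentiableAt hx).hasMFDerivAt
  have h2 := (hΦ s hs x).2 t hst
  rw [coordField_apply_chart hx]
  let v : EuclideanSpace ℝ (Fin n) := mfderiv (𝓡 n) (𝓡 n) e (Φ t s x) (f (Φ t s x) t)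
  have h3 : HasFDerivWithinAt (fun τ => e (Φ τ s x)) ((1 : ℝ →L[ℝ] ℝ).smulRight v) (Ici s) t := by
    have h4 := (h1.comp_hasMFDerivWithinAt t h2).hasFDerivWithinAt
    refine h4.congr_fderiv ?_
    ext1
    exact map_smul (mfderiv (𝓡 n) (𝓡 n) e (Φ t s x)) (1 : ℝ) (f (Φ t s x) t)
  have h5 := h3.hasDerivWithinAt
  simp only [ContinuousLinearMap.smulRight_apply, one_apply_eq_self, one_smul] at h5
  exact h5

/-- The trajectories of the flow near the equilibrium, in coordinates centered at it. -/
theorem IsFlow.exists_isUniformlyStableFamily (hΦ : IsFlow J f Φ)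
    (he : e ∈ IsManifold.maximalAtlas (𝓡 n) ∞ M) (hxe : xbar ∈ e.source) {b : ℝ≥0∞}
    (hb : ∀ x ∈ e.source, edist x xbar < b) {β : ℝ → ℝ → ℝ} (hβ : IsClassKL b β)
    (hbound : ∀ s ∈ J, ∀ x₀ ∈ e.source, ∀ t, s ≤ t →
      dist (Φ t s x₀) xbar ≤ β (dist x₀ xbar) (t - s)) {R : ℝ} (hR : 0 < R) :
    ∃ δ > 0, ∃ Y, IsUniformlyStableFamily J (fun y t => coordField e f (e xbar + y) t) δ R Y := by
  obtain ⟨ε₀, hε₀, hε₀'⟩ := exists_dist_lt_imp_norm_chart_lt hxe hR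
  obtain ⟨η₁, hη₁, hstab⟩ := hβ.exists_forall_dist_lt hxe hb hbound hε₀
  obtain ⟨η₂, hη₂, hattr⟩ := hβ.exists_forall_dist_lt_of_le hxe hb hbound
  obtain ⟨δ, hδ, hδ'⟩ := exists_norm_lt_imp_dist_symm_lt hxe (lt_min hη₁ hη₂)
  have hsrc : ∀ y, ‖y‖ < δ → e.symm (e xbar + y) ∈ e.source := fun y hy =>
    e.map_target (hδ' y hy).1
  have hnear : ∀ s ∈ J, ∀ y, ‖y‖ < δ → ∀ t, s ≤ t →
      Φ t s (e.symm (e xbar + y)) ∈ e.source ∧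
      ‖e (Φ t s (e.symm (e xbar + y))) - e xbar‖ < R := fun s hs y hy t hst =>
    hε₀' _ (hstab s hs _ (hsrc y hy) ((hδ' y hy).2.trans_le (min_le_left _ _)) t hst)
  -- Frozen for negative `τ`, where the flow is not controlled, so that the curve is continuous on
  -- all of `ℝ`.
  let Y : ℝ → EuclideanSpace ℝ (Fin n) → ℝ → EuclideanSpace ℝ (Fin n) := fun s y τ =>
    e (Φ (s + max τ 0) s (e.symm (e xbar + y))) - e xbar
  have hYpos : ∀ s y τ, 0 ≤ τ → Y s y τ = e (Φ (s + τ) s (e.symm (e xbar + y))) - e xbar :=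
    fun s y τ hτ => by simp only [Y, max_eq_left hτ]
  refine ⟨δ, hδ, Y, ?_, ?_, ?_, ?_, ?_, ?_⟩
  · intro s hs y hy
    rw [hYpos s y 0 le_rfl, add_zero, (hΦ s hs _).1, e.right_inv (hδ' y hy).1, add_sub_cancel_left]
  · intro s hs y hy
    have h1 : ContinuousOn (fun t => e (Φ t s (e.symm (e xbar + y)))) (Ici s) := fun t ht =>
      (hΦ.hasDerivWithinAt_chart he hs ht (hnear s hs y hy t ht).1).continuousWithinAt
    refine (h1.comp_continuous (f := fun τ : ℝ => s + max τ 0) (by fun_prop) fun τ => ?_).sub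
      continuous_const
    exact le_add_of_nonneg_right (le_max_right τ 0)
  · intro s hs y hy τ hτ
    have hst : s ≤ s + τ := by linarith
    have h1 := (hΦ.hasDerivWithinAt_chart he hs hst (hnear s hs y hy _ hst).1).mono
      (Ici_subset_Ici.2 hst)
    have h2 : HasDerivWithinAt (fun τ => s + τ) 1 (Ici τ) τ :=
      (hasDerivWithinAt_id τ _).const_add s
    have h3 := (HasDerivWithinAt.scomp τ h1 h2 (fun x hx => by
      simp only [mem_Ici] at hx ⊢; linarith)).sub_const (e xbar)
    rw [one_smul] at h3
    rw [hYpos s y τ hτ, add_sub_cancel]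
    exact h3.congr (fun σ hσ => hYpos s y σ (hτ.trans hσ)) (hYpos s y τ hτ)
  · intro s hs y hy τ hτ
    rw [hYpos s y τ hτ]
    exact (hnear s hs y hy _ (by linarith)).2
  · intro ε hε
    obtain ⟨ε', hε', h1⟩ := exists_dist_lt_imp_norm_chart_lt hxe hε
    obtain ⟨η, hη, h2⟩ := hβ.exists_forall_dist_lt hxe hb hbound hε'
    obtain ⟨δ', hδ'', h3⟩ := exists_norm_lt_imp_dist_symm_lt hxe hη
    refine ⟨δ', hδ'', fun s hs y hy hy' τ hτ => ?_⟩
    rw [hYpos s y τ hτ]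
    exact (h1 _ (h2 s hs _ (hsrc y hy) (h3 y hy').2 _ (by linarith))).2
  · intro ε hε
    obtain ⟨ε', hε', h1⟩ := exists_dist_lt_imp_norm_chart_lt hxe hε
    obtain ⟨T, hT⟩ := hattr ε' hε'
    refine ⟨T, fun s hs y hy τ hτ hTτ => ?_⟩
    rw [hYpos s y τ hτ]
    exact (h1 _ (hT s hs _ (hsrc y hy) ((hδ' y hy).2.trans_le (min_le_right _ _)) _
      (by linarith) (by linarith))).2

/-- The constant curve is the trajectory from the equilibrium, and right derivatives are unique. -/
theorem IsEquilibrium.field_eq_zero (hΦ : IsFlow J f Φ) (hxbar : IsEquilibrium J Φ xbar)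
    (he : e ∈ IsManifold.maximalAtlas (𝓡 n) ∞ M) (hxe : xbar ∈ e.source) {t : ℝ} (ht : t ∈ J) :
    coordField e f (e xbar) t = 0 := by
  have hfix : ∀ τ, t ≤ τ → Φ τ t xbar = xbar := hxbar t ht
  have h1 := hΦ.hasDerivWithinAt_chart he ht le_rfl (x := xbar) (by rwa [hfix t le_rfl])
  rw [hfix t le_rfl] at h1
  have h2 : HasDerivWithinAt (fun τ => e (Φ τ t xbar)) 0 (Ici t) t :=
    (hasDerivWithinAt_const t (Ici t) (e xbar)).congr (fun τ hτ => by rw [hfix τ hτ])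
      (by rw [hfix t le_rfl])
  exact (uniqueDiffOn_Ici t t self_mem_Ici).eq_deriv _ h1 h2

end Flow

end Chart

/-! ### Extension by zero from the chart to the manifold -/

section Transfer

variable {n : ℕ} {M : Type*} [TopologicalSpace M]

open Classical in
/-- The function on `M × ℝ` with coordinate expression `W` in the chart `e` centered at `xbar`,
extended by zero. -/
noncomputable def chartExtension (e : OpenPartialHomeomorph M (EuclideanSpace ℝ (Fin n)))
    (xbar : M) (W : EuclideanSpace ℝ (Fin n) × ℝ → ℝ) (p : M × ℝ) : ℝ :=
  if p.1 ∈ e.source then W (e p.1 - e xbar, p.2) else 0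

variable {e : OpenPartialHomeomorph M (EuclideanSpace ℝ (Fin n))} {xbar : M}
  {W : EuclideanSpace ℝ (Fin n) × ℝ → ℝ}

theorem chartExtension_of_mem {x : M} (hx : x ∈ e.source) (t : ℝ) :
    chartExtension e xbar W (x, t) = W (e x - e xbar, t) := by
  simp [chartExtension, hx]

theorem hasDerivAt_chartExtension (hW : ContDiff ℝ ∞ W) {x : M} (hx : x ∈ e.source) (t : ℝ) :
    HasDerivAt (fun τ => chartExtension e xbar W (x, τ))
      (fderiv ℝ W (e x - e xbar, t) (0, 1)) t := by
  have h1 : HasDerivAt (fun τ : ℝ => (e x - e xbar, τ)) (0, 1) t :=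
    (hasDerivAt_const t _).prodMk (hasDerivAt_id t)
  have h2 := (((hW.differentiable (by simp)) (e x - e xbar, t)).hasFDerivAt).comp_hasDerivAt t h1
  rw [show (fun τ => chartExtension e xbar W (x, τ)) = W ∘ fun τ : ℝ => (e x - e xbar, τ) from
    funext fun τ => chartExtension_of_mem hx τ]
  exact h2

variable [ChartedSpace (EuclideanSpace ℝ (Fin n)) M]

/-- The spatial support lies in the image of a closed ball, which is compact, hence closed in a
Hausdorff space. Points outside the chart domain thus have neighbourhoods where the function is
zero. -/
theorem contMDiff_chartExtension [T2Space M] (he : e ∈ IsManifold.maximalAtlas (𝓡 n) ∞ M)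
    (hW : ContDiff ℝ ∞ W) {r : ℝ} (hr : Metric.closedBall (e xbar) r ⊆ e.target)
    (hWr : ∀ p, r ≤ ‖p.1‖ → W p = 0) :
    ContMDiff ((𝓡 n).prod 𝓘(ℝ, ℝ)) 𝓘(ℝ, ℝ) ∞ (chartExtension e xbar W) := by
  intro p
  by_cases hp : p.1 ∈ e.source
  · have h1 : ContMDiffOn ((𝓡 n).prod 𝓘(ℝ, ℝ)) (𝓡 n) ∞ (fun p : M × ℝ => e p.1)
        (e.source ×ˢ univ) :=
      (contMDiffOn_of_mem_maximalAtlas he).comp contMDiff_fst.contMDiffOn (fun p hp => hp.1)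
    have h2 : ContMDiffOn ((𝓡 n).prod 𝓘(ℝ, ℝ)) 𝓘(ℝ, EuclideanSpace ℝ (Fin n) × ℝ) ∞
        (fun p : M × ℝ => (e p.1, p.2)) (e.source ×ˢ univ) :=
      h1.prodMk_space contMDiff_snd.contMDiffOn
    have h3 : ContDiff ℝ ∞ (fun q : EuclideanSpace ℝ (Fin n) × ℝ => W (q.1 - e xbar, q.2)) :=
      hW.comp ((contDiff_fst.sub contDiff_const).prodMk contDiff_snd)
    have h4 := h3.contMDiff.comp_contMDiffOn h2
    have hmem : e.source ×ˢ univ ∈ 𝓝 p :=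
      (e.open_source.prod isOpen_univ).mem_nhds ⟨hp, mem_univ _⟩
    refine (h4.contMDiffAt hmem).congr_of_eventuallyEq ?_
    filter_upwards [hmem] with q hq
    exact chartExtension_of_mem hq.1 q.2
  · have hS : IsCompact (e.symm '' Metric.closedBall (e xbar) r) :=
      (isCompact_closedBall _ _).image_of_continuousOn (e.continuousOn_symm.mono hr)
    have hpS : p.1 ∉ e.symm '' Metric.closedBall (e xbar) r := by
      rintro ⟨z, hz, hzp⟩
      exact hp (hzp ▸ e.map_target (hr hz))
    have hmem : (e.symm '' Metric.closedBall (e xbar) r)ᶜ ×ˢ univ ∈ 𝓝 p :=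
      (hS.isClosed.isOpen_compl.prod isOpen_univ).mem_nhds ⟨hpS, mem_univ _⟩
    refine (contMDiffAt_const (c := (0 : ℝ))).congr_of_eventuallyEq ?_
    filter_upwards [hmem] with q hq
    by_cases hqs : q.1 ∈ e.source
    · rw [show q = (q.1, q.2) from rfl, chartExtension_of_mem hqs]
      refine hWr _ ?_
      by_contra h
      refine hq.1 ⟨e q.1, ?_, e.left_inv hqs⟩
      rw [Metric.mem_closedBall, dist_eq_norm]
      exact (not_le.1 h).le
    · simp [chartExtension, hqs]

theorem mfderiv_chartExtension_apply (he : e ∈ IsManifold.maximalAtlas (𝓡 n) ∞ M)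
    (hW : ContDiff ℝ ∞ W) {x : M} (hx : x ∈ e.source) (t : ℝ) (X : TangentSpace (𝓡 n) x) :
    mfderiv (𝓡 n) 𝓘(ℝ, ℝ) (fun y => chartExtension e xbar W (y, t)) x X =
      fderiv ℝ W (e x - e xbar, t) (mfderiv (𝓡 n) (𝓡 n) e x X, 0) := by
  have h1 := ((mdifferentiable_of_mem_maximalAtlas he).mdifferentiableAt hx).hasMFDerivAt
  have h2 : HasFDerivAt (fun z => W (z - e xbar, t))
      ((fderiv ℝ W (e x - e xbar, t)).comp (ContinuousLinearMap.inl ℝ _ ℝ)) (e x) := by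
    have h3 : HasFDerivAt (fun z : EuclideanSpace ℝ (Fin n) => (z - e xbar, t))
        (ContinuousLinearMap.inl ℝ (EuclideanSpace ℝ (Fin n)) ℝ) (e x) :=
      ((hasFDerivAt_id (e x)).sub_const (e xbar)).prodMk (hasFDerivAt_const t (e x))
    exact HasFDerivAt.comp (g := W) (e x)
      ((hW.differentiable (by simp)) (e x - e xbar, t)).hasFDerivAt h3
  have h4 := HasMFDerivAt.comp x h2.hasMFDerivAt h1
  have hev : (fun y => chartExtension e xbar W (y, t)) =ᶠ[𝓝 x]
      (fun z => W (z - e xbar, t)) ∘ e := by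
    filter_upwards [e.open_source.mem_nhds hx] with y hy
    exact chartExtension_of_mem hy t
  rw [(h4.congr_of_eventuallyEq hev).mfderiv]
  rfl

theorem lieDerivative_chartExtension (he : e ∈ IsManifold.maximalAtlas (𝓡 n) ∞ M)
    (hW : ContDiff ℝ ∞ W) (f : (x : M) → ℝ → TangentSpace (𝓡 n) x) {x : M} (hx : x ∈ e.source)
    (t : ℝ) :
    lieDerivative f (chartExtension e xbar W) x t =
      fderiv ℝ W (e x - e xbar, t) (coordField e f (e x) t, 1) := by
  have h1 := mfderiv_chartExtension_apply (xbar := xbar) he hW hx t (f x t)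
  rw [coordField_apply_chart (f := f) hx t]
  simp only [lieDerivative]
  rw [(hasDerivAt_chartExtension hW hx t).deriv]
  refine (congrArg (· + fderiv ℝ W (e x - e xbar, t) (0, 1)) h1).trans ?_
  have h2 : ∀ u : EuclideanSpace ℝ (Fin n), fderiv ℝ W (e x - e xbar, t) (u, 0) +
      fderiv ℝ W (e x - e xbar, t) (0, 1) = fderiv ℝ W (e x - e xbar, t) (u, 1) := fun u => by
    rw [← map_add, Prod.mk_add_mk, add_zero, zero_add]
  exact h2 _

end Transfer

/-! ### The Riemannian norm of the differential -/

section Norm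

variable {n : ℕ} {M : Type*} [TopologicalSpace M] [ChartedSpace (EuclideanSpace ℝ (Fin n)) M]
  [RiemannianBundle (fun x : M => TangentSpace (𝓡 n) x)]
  {e : OpenPartialHomeomorph M (EuclideanSpace ℝ (Fin n))}

theorem norm_mfderiv_chartExtension_le (he : e ∈ IsManifold.maximalAtlas (𝓡 n) ∞ M) {xbar : M}
    {W : EuclideanSpace ℝ (Fin n) × ℝ → ℝ} (hW : ContDiff ℝ ∞ W) {x : M} (hx : x ∈ e.source)
    {t a C : ℝ} (ha : 0 < a) (hC : 0 ≤ C)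
    (h : ∀ u : EuclideanSpace ℝ (Fin n),
      a * ‖u‖ ≤ ‖(mfderiv (𝓡 n) (𝓡 n) e.symm (e x) u : TangentSpace (𝓡 n) (e.symm (e x)))‖)
    (hWC : ∀ u, |fderiv ℝ W (e x - e xbar, t) (u, 0)| ≤ C * ‖u‖) :
    ‖mfderiv (𝓡 n) 𝓘(ℝ, ℝ) (fun y => chartExtension e xbar W (y, t)) x‖ ≤ a⁻¹ * C := by
  refine ContinuousLinearMap.opNorm_le_bound _ (by positivity) fun X => ?_
  rw [norm_tangentSpace_vectorSpace]
  have h1 := mfderiv_chartExtension_apply (xbar := xbar) he hW hx t X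
  let u : EuclideanSpace ℝ (Fin n) := mfderiv (𝓡 n) (𝓡 n) e x X
  have h2 : ‖(mfderiv (𝓡 n) (𝓡 n) e.symm (e x) u : TangentSpace (𝓡 n) (e.symm (e x)))‖ =
      ‖X‖ := by
    have h3 := congrArg (fun A => A X)
      ((mdifferentiable_of_mem_maximalAtlas he).symm_comp_deriv hx)
    -- The norm depends on the base point, so `e.symm (e x) = x` must be used to move between the
    -- two tangent spaces.
    have h4 : ∀ (z : M) (_ : z = x) (Z : EuclideanSpace ℝ (Fin n)),
        ‖(show TangentSpace (𝓡 n) z from Z)‖ = ‖(show TangentSpace (𝓡 n) x from Z)‖ := by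
      rintro z rfl Z
      rfl
    refine (h4 _ (e.left_inv hx) _).trans ?_
    exact congrArg (fun Z : TangentSpace (𝓡 n) x => ‖Z‖) h3
  have h5 := h u
  rw [h2] at h5
  calc ‖(show ℝ from mfderiv (𝓡 n) 𝓘(ℝ, ℝ) (fun y => chartExtension e xbar W (y, t)) x X)‖
      = |fderiv ℝ W (e x - e xbar, t) (u, 0)| := congrArg (fun z : ℝ => ‖z‖) h1
    _ ≤ C * ‖u‖ := hWC u
    _ ≤ C * (a⁻¹ * ‖X‖) := by
      gcongr
      rwa [le_inv_mul_iff₀ ha]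
    _ = a⁻¹ * C * ‖X‖ := by ring

end Norm

/-! ### The converse Lyapunov theorem on the manifold -/

theorem theorem6 {n : ℕ} {M : Type*} [MetricSpace M]
    [ChartedSpace (EuclideanSpace ℝ (Fin n)) M] [IsManifold (𝓡 n) ∞ M]
    [RiemannianBundle (fun x : M => TangentSpace (𝓡 n) x)]
    [IsContMDiffRiemannianBundle (𝓡 n) ∞ (EuclideanSpace ℝ (Fin n))
      (fun x : M => TangentSpace (𝓡 n) x)]
    [IsRiemannianManifold (𝓡 n) M]
    (J : Set ℝ) (hJ : J = Set.univ ∨ ∃ t₀ : ℝ, J = Set.Ici t₀)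
    (f : (x : M) → ℝ → TangentSpace (𝓡 n) x) (hf : IsSmoothTimeVaryingField f)
    (Φ : ℝ → ℝ → M → M) (hΦ : IsFlow J f Φ)
    (xbar : M) (hxbar : IsEquilibrium J Φ xbar)
    (e : OpenPartialHomeomorph M (EuclideanSpace ℝ (Fin n)))
    (he : e ∈ IsManifold.maximalAtlas (𝓡 n) ∞ M) (hxe : xbar ∈ e.source)
    (b : ℝ≥0∞) (hb : ∀ x ∈ e.source, edist x xbar < b)
    (β : ℝ → ℝ → ℝ) (hβ : IsClassKL b β)
    (hbound : ∀ s ∈ J, ∀ x₀ ∈ e.source, ∀ t, s ≤ t →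
      dist (Φ t s x₀) xbar ≤ β (dist x₀ xbar) (t - s))
    (hTf : HasBoundedPushforward J e f) :
    ∃ U : Set M, IsOpen U ∧ xbar ∈ U ∧ U ⊆ e.source ∧
      ∃ (w : M × ℝ → ℝ) (α₁ α₂ α₃ α₄ : ℝ → ℝ),
        IsLyapunovFunction J f xbar w ∧ (∀ p, 0 ≤ w p) ∧
        IsClassK ⊤ α₁ ∧ IsClassK ⊤ α₂ ∧ IsClassK ⊤ α₃ ∧ IsClassK ⊤ α₄ ∧
        ∀ x ∈ U, ∀ t ∈ J,
          (α₁ (dist x xbar) ≤ w (x, t) ∧ w (x, t) ≤ α₂ (dist x xbar)) ∧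
          lieDerivative f w x t ≤ -α₃ (dist x xbar) ∧
          ‖mfderiv (𝓡 n) 𝓘(ℝ, ℝ) (fun y => w (y, t)) x‖ ≤ α₄ (dist x xbar) := by
  have hxt := e.map_source hxe
  obtain ⟨R, hR, hRe⟩ := Metric.nhds_basis_closedBall.mem_iff.1 (e.open_target.mem_nhds hxt)
  set c := e xbar with hc
  let F : EuclideanSpace ℝ (Fin n) → ℝ → EuclideanSpace ℝ (Fin n) := fun y t =>
    coordField e f (c + y) t
  have hadd : ∀ y ∈ Metric.ball (0 : EuclideanSpace ℝ (Fin n)) R,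
      c + y ∈ Metric.closedBall c R := fun y hy => by
    rw [Metric.mem_closedBall, dist_eq_norm, add_sub_cancel_left]
    simpa using (Metric.mem_ball.1 hy).le
  have hF : ContDiffOn ℝ ∞ (fun p : EuclideanSpace ℝ (Fin n) × ℝ => F p.1 p.2)
      (Metric.ball 0 R ×ˢ univ) :=
    (contDiffOn_coordField he hf).comp
      ((contDiff_const.add contDiff_fst).prodMk contDiff_snd).contDiffOn
      (fun p hp => ⟨hRe (hadd _ hp.1), mem_univ _⟩)
  have hF0 : ∀ t ∈ J, F 0 t = 0 := fun t ht => by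
    simp only [F, add_zero]
    exact hxbar.field_eq_zero hΦ he hxe ht
  have hFd : ∀ t, ∀ y ∈ Metric.ball (0 : EuclideanSpace ℝ (Fin n)) R,
      DifferentiableAt ℝ (fun y => F y t) y := fun t y hy => by
    have h1 := (hF.contDiffAt ((Metric.isOpen_ball.prod isOpen_univ).mem_nhds
      (show (y, t) ∈ _ from ⟨hy, mem_univ t⟩))).differentiableAt (by simp)
    exact DifferentiableAt.comp (g := fun p : EuclideanSpace ℝ (Fin n) × ℝ => F p.1 p.2)
      (f := fun y => (y, t)) y h1 (differentiableAt_id.prodMk (differentiableAt_const t))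
  obtain ⟨A, hA, C, hC, hAC⟩ :=
    exists_norm_fderiv_coordField_le he hf hTf (isCompact_closedBall c R) hRe
  have hL : ∀ t ∈ J, ∀ y ∈ Metric.ball (0 : EuclideanSpace ℝ (Fin n)) R,
      ‖fderiv ℝ (fun y => F y t) y‖ ≤ A + C * gronwallBound 0 (C * R) (A * R) 1 := by
    intro t ht
    refine norm_fderiv_le_of_affine_bound (hFd t) (hF0 t ht) hA hC fun y hy u => ?_
    have h1 := hAC t ht (c + y) (hadd y hy) u
    rwa [← fderiv_comp_add_left] at h1
  obtain ⟨δ, hδ, Y, hY⟩ :=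
    hΦ.exists_isUniformlyStableFamily he hxe hb hβ hbound (half_pos hR)
  obtain ⟨W, hW, hW0, hWR, δ₁, hδ₁, hδR, hdec, hlow, ⟨B, hB⟩, hsmall⟩ :=
    exists_lyapunov_of_contDiffOn hJ hR hF hL hF0 hδ hY
  obtain ⟨a, ha, _, -, hab⟩ := exists_norm_mfderiv_symm_bounds he (isCompact_closedBall c R) hRe
  have hJ' : ∀ s ∈ J, ∀ t, s ≤ t → t ∈ J := by
    rcases hJ with rfl | ⟨t₀, rfl⟩
    · exact fun _ _ _ _ => mem_univ _
    · exact fun s hs t hst => le_trans hs hst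
  let w := chartExtension e xbar W
  have hw : ContMDiff ((𝓡 n).prod 𝓘(ℝ, ℝ)) 𝓘(ℝ, ℝ) ∞ w :=
    contMDiff_chartExtension he hW
      ((Metric.closedBall_subset_closedBall (half_le_self hR.le)).trans hRe) hWR
  have hw0 : ∀ p, 0 ≤ w p := fun p => by
    simp only [w, chartExtension]
    split_ifs
    exacts [hW0 _, le_rfl]
  let U : Set M := e.source ∩ e ⁻¹' Metric.ball c δ₁
  have hUopen : IsOpen U := e.isOpen_inter_preimage Metric.isOpen_ball
  have hUx : xbar ∈ U := ⟨hxe, by simpa [hc] using hδ₁⟩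
  have hUn : ∀ x ∈ U, ‖e x - c‖ < δ₁ := fun x hx => by
    rw [← dist_eq_norm]; exact hx.2
  have hwW : ∀ x ∈ U, ∀ t, w (x, t) = W (e x - c, t) := fun x hx t => chartExtension_of_mem hx.1 t
  have hlie : ∀ x ∈ U, ∀ t, lieDerivative f w x t = fderiv ℝ W (e x - c, t) (F (e x - c) t, 1) :=
    fun x hx t => by
      simp only [F, add_sub_cancel]
      exact lieDerivative_chartExtension he hW f hx.1 t
  have hnorm : ∀ x ∈ U, ∀ t, ∀ D : ℝ, 0 ≤ D →
      (∀ u, |fderiv ℝ W (e x - c, t) (u, 0)| ≤ D * ‖u‖) →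
      ‖mfderiv (𝓡 n) 𝓘(ℝ, ℝ) (fun y => w (y, t)) x‖ ≤ a⁻¹ * D := fun x hx t D hD h => by
    refine norm_mfderiv_chartExtension_le he hW hx.1 ha hD (fun u => (hab (e x) ?_ u).1) h
    rw [Metric.mem_closedBall, dist_eq_norm]
    linarith [hUn x hx]
  -- Points and times form one index set, so the comparison functions obtained do not depend on
  -- time.
  let S := {p : M × ℝ // p.1 ∈ U ∧ p.2 ∈ J}
  let ρ : S → ℝ := fun s => dist s.1.1 xbar
  have hρ : ∀ s, 0 ≤ ρ s := fun s => dist_nonneg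
  have hfar : ∀ r > 0, ∃ c' > 0, ∀ s : S, r ≤ ρ s →
      c' ≤ w s.1 ∧ c' ≤ -lieDerivative f w s.1.1 s.1.2 := by
    intro r hr
    obtain ⟨r', hr', h1⟩ := exists_norm_lt_imp_dist_symm_lt hxe hr
    obtain ⟨c', hc', h2⟩ := hlow r' hr'
    refine ⟨c', hc', fun ⟨⟨x, t⟩, hx, ht⟩ hrs => ?_⟩
    have h3 : r' ≤ ‖e x - c‖ := by
      by_contra h
      have h4 := (h1 _ (not_le.1 h)).2
      rw [add_sub_cancel, e.left_inv hx.1] at h4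
      exact absurd hrs (not_le.2 h4)
    obtain ⟨h5, h6⟩ := h2 t ht _ (hUn x hx) h3
    simp only
    rw [hwW x hx t, hlie x hx t]
    exact ⟨h5, by linarith⟩
  have hnear : ∀ ε > 0, ∃ η > 0, ∀ s : S, ρ s < η → w s.1 ≤ ε ∧
      ‖mfderiv (𝓡 n) 𝓘(ℝ, ℝ) (fun y => w (y, s.1.2)) s.1.1‖ ≤ ε := by
    intro ε hε
    -- The factor `a` offsets the `a⁻¹` lost in passing from Euclidean to Riemannian norms of the
    -- differential.
    obtain ⟨δ', hδ', h1⟩ := hsmall (min ε (a * ε)) (lt_min hε (mul_pos ha hε))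
    obtain ⟨η, hη, h2⟩ := exists_dist_lt_imp_norm_chart_lt hxe hδ'
    refine ⟨η, hη, fun ⟨⟨x, t⟩, hx, ht⟩ hs => ?_⟩
    obtain ⟨h3, h4⟩ := h1 t ht _ (hUn x hx) (h2 x hs).2
    simp only
    refine ⟨(hwW x hx t).trans_le (h3.trans (min_le_left _ _)), ?_⟩
    refine (hnorm x hx t (a * ε) (by positivity) fun u => (h4 u).trans ?_).trans (le_of_eq ?_)
    · exact mul_le_mul_of_nonneg_right (min_le_right _ _) (norm_nonneg _)
    · field_simp
  obtain ⟨α₁, hα₁, h₁⟩ := exists_isClassK_le (q := fun s : S => w s.1) hρ (fun s => hw0 _)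
    fun r hr => let ⟨c', hc', h⟩ := hfar r hr; ⟨c', hc', fun s hs => (h s hs).1⟩
  obtain ⟨α₂, hα₂, h₂⟩ := exists_isClassK_ge (q := fun s : S => w s.1) hρ (B := B)
    (fun ⟨⟨x, t⟩, hx, ht⟩ => (hwW x hx t).trans_le (hB t ht _ (hUn x hx)).1)
    fun ε hε => let ⟨η, hη, h⟩ := hnear ε hε; ⟨η, hη, fun s hs => (h s hs).1⟩
  have hlie0 : ∀ x ∈ U, ∀ t ∈ J, lieDerivative f w x t ≤ 0 := fun x hx t ht => by
    rw [hlie x hx t]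
    exact hdec t ht _ (hUn x hx)
  obtain ⟨α₃, hα₃, h₃⟩ := exists_isClassK_le (q := fun s : S => -lieDerivative f w s.1.1 s.1.2) hρ
    (fun ⟨⟨x, t⟩, hx, ht⟩ => neg_nonneg.2 (hlie0 x hx t ht))
    fun r hr => let ⟨c', hc', h⟩ := hfar r hr; ⟨c', hc', fun s hs => (h s hs).2⟩
  obtain ⟨α₄, hα₄, h₄⟩ := exists_isClassK_ge
    (q := fun s : S => ‖mfderiv (𝓡 n) 𝓘(ℝ, ℝ) (fun y => w (y, s.1.2)) s.1.1‖) hρ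
    (B := a⁻¹ * |B|)
    (fun ⟨⟨x, t⟩, hx, ht⟩ => hnorm x hx t _ (abs_nonneg B) fun u =>
      ((hB t ht _ (hUn x hx)).2 u).trans
        (mul_le_mul_of_nonneg_right (le_abs_self B) (norm_nonneg _)))
    fun ε hε => let ⟨η, hη, h⟩ := hnear ε hε; ⟨η, hη, fun s hs => (h s hs).2⟩
  have hwx : ∀ t ∈ J, w (xbar, t) = 0 := fun t ht => by
    refine le_antisymm ?_ (hw0 _)
    have := h₂ ⟨(xbar, t), hUx, ht⟩
    simp only [ρ, dist_self] at this
    rwa [hα₂.2.2] at this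
  -- The field vanishes at the equilibrium, leaving the time derivative. Since `w (xbar, ·)` is
  -- known to vanish only on `J`, it is computed from the right, which also covers the endpoint of
  -- `J`.
  have hlx : ∀ t ∈ J, lieDerivative f w xbar t = 0 := fun t ht => by
    have h1 := (hasDerivAt_chartExtension (xbar := xbar) hW hxe t).hasDerivWithinAt (s := Ici t)
    have h2 : HasDerivWithinAt (fun τ => chartExtension e xbar W (xbar, τ)) 0 (Ici t) t :=
      (hasDerivWithinAt_const t (Ici t) (0 : ℝ)).congr (fun τ hτ => hwx τ (hJ' t ht τ hτ))
        (hwx t ht)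
    rw [hlie xbar hUx t, show e xbar - c = 0 from sub_self _, hF0 t ht]
    have h3 := (uniqueDiffOn_Ici t t self_mem_Ici).eq_deriv _ h1 h2
    rwa [sub_self] at h3
  refine ⟨U, hUopen, hUx, inter_subset_left, w, α₁, α₂, α₃, α₄,
    ⟨hw, U, hUopen.mem_nhds hUx, fun t ht => ⟨⟨hwx t ht, fun x hx hne => ?_⟩, hlx t ht,
      fun x hx _ => hlie0 x hx t ht⟩⟩, hw0, hα₁, hα₂, hα₃, hα₄, fun x hx t ht =>
    ⟨⟨h₁ ⟨(x, t), hx, ht⟩, h₂ ⟨(x, t), hx, ht⟩⟩, ?_, h₄ ⟨(x, t), hx, ht⟩⟩⟩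
  · have h1 : 0 < dist x xbar := dist_pos.2 hne
    have h2 := hα₁.2.1 (mem_comparisonDomain_top.2 le_rfl) (mem_comparisonDomain_top.2 h1.le) h1
    rw [hα₁.2.2] at h2
    exact h2.trans_le (h₁ ⟨(x, t), hx, ht⟩)
  · have := h₃ ⟨(x, t), hx, ht⟩
    simp only [ρ] at this
    linarith
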